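/- Let $A$ and $B$ be (possibly unbounded) self-adjoint operators in a complex Hilbert space $\mathcal H$, let $K$ be a bounded operator in $\mathcal H$, and let $z\in\mathbb C$ belong to the resolvent sets of both $A$ and $B$. Let $E_\lambda$ denote the spectral projections of $B$, let $P_{ac}(B)$ be the orthogonal projection onto the absolutely continuous subspace of $B$ (the closed subspace of all $\varphi$ for which the measure $d(\varphi,E_\lambda\varphi)$ is absolutely continuous with respect to Lebesgue measure), and let $\mathcal M(B)$ be the set of all $\varphi\in\mathcal H$ such that $d(\varphi,E_\lambda\varphi)=|f(\lambda)|^2\,d\lambda$ for some $f\in L^\infty(\mathbb R)$. Suppose that $$K(B-z)^{-1}-(A-z)^{-1}K=C_1+C_2,$$ where $C_1$ is a trace class operator and $C_2$ is a bounded operator in $\mathcal H$. Suppose further that there is a subset $M\subset\mathcal M(B)$, dense in $\mathcal M(B)$ in the norm of $\mathcal H$, such that for every $\varphi\in M$ $$\lim_{t\to+\infty}C_2e^{-iBt}\varphi=0\quad\text{and}\quad\int_0^{+\infty}\|C_2e^{-iBt}\varphi\|\,dt<\infty.$$ Then the strong limit $$\Omega_{out}(A,B;K)=\operatorname*{s-lim}_{t\to+\infty}e^{iAt}Ke^{-iBt}P_{ac}(B)$$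 exists; that is, there is a bounded operator $\Omega_{out}(A,B;K)$ in $\mathcal H$ such that $e^{iAt}Ke^{-iBt}P_{ac}(B)\varphi\to\Omega_{out}(A,B;K)\varphi$ in norm as $t\to+\infty$ for every $\varphi\in\mathcal H$. -/

import Mathlib

open MeasureTheory Filter Topology
open scoped ENNReal InnerProductSpace

noncomputable section

namespace Scattering

variable {H : Type*} [NormedAddCommGroup H] [InnerProductSpace ℂ H] [CompleteSpace H]

/-! ### Resolvents of unbounded operators -/

/-- `R` is the bounded everywhere defined two-sided inverse of `A - z : D(A) → H`. -/
def IsResolventAt (A : H →ₗ.[ℂ] H) (z : ℂ) (R : H →L[ℂ] H) : Prop :=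
  (∀ ψ : H, ∃ h : R ψ ∈ A.domain, A ⟨R ψ, h⟩ - z • R ψ = ψ) ∧
    ∀ φ : A.domain, R (A φ - z • (φ : H)) = φ

/-- The resolvent set of an unbounded operator. -/
def resolventSet (A : H →ₗ.[ℂ] H) : Set ℂ := {z | ∃ R : H →L[ℂ] H, IsResolventAt A z R}

open Classical in
/-- The resolvent `(A - z)⁻¹`, for `z` in the resolvent set (and `0` elsewhere). -/
def resolvent (A : H →ₗ.[ℂ] H) (z : ℂ) : H →L[ℂ] H :=
  if h : ∃ R : H →L[ℂ] H, IsResolventAt A z R then h.choose else 0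

/-! ### Trace class operators -/

/-- `T` is trace class: `Tr |T| = ∑ ⟨e, |T| e⟩ < ∞`, where `|T| = (T⋆ T)^{1/2}` and `e` runs through
an orthonormal basis. (The value of the sum does not depend on the basis.) -/
def IsTraceClass (T : H →L[ℂ] H) : Prop :=
  ∃ (s : Set H) (b : HilbertBasis s ℂ H), Summable fun i => (⟪b i, CFC.abs T (b i)⟫_ℂ).re

/-! ### Projection-valued measures on the real line -/

/-- Projection-valued measures on the Borel sets of `ℝ`; values on non-Borel sets are irrelevant. -/
structure ProjectionValuedMeasure (H : Type*) [NormedAddCommGroup H] [InnerProductSpace ℂ H]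
    [CompleteSpace H] where
  proj : Set ℝ → H →L[ℂ] H
  isStarProjection : ∀ S, MeasurableSet S → IsStarProjection (proj S)
  proj_univ : proj Set.univ = 1
  proj_inter : ∀ S T, MeasurableSet S → MeasurableSet T → proj (S ∩ T) = proj S * proj T
  hasSum_proj : ∀ S : ℕ → Set ℝ, (∀ n, MeasurableSet (S n)) →
    Pairwise (Function.onFun Disjoint S) →
    ∀ φ : H, HasSum (fun n => proj (S n) φ) (proj (⋃ n, S n) φ)

namespace ProjectionValuedMeasure

open Classical in
/-- The projection-valued measure concentrated at the point `0`. -/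
instance : Inhabited (ProjectionValuedMeasure H) where
  default :=
    { proj := fun S => if (0 : ℝ) ∈ S then 1 else 0
      isStarProjection := fun S _ => by
        by_cases h : (0 : ℝ) ∈ S
        · simp [h]
        · simp [h]
      proj_univ := by simp
      proj_inter := fun S T _ _ => by
        by_cases h : (0 : ℝ) ∈ S <;> by_cases h' : (0 : ℝ) ∈ T <;> simp [h, h']
      hasSum_proj := fun S _ hd φ => by
        by_cases h : ∃ n, (0 : ℝ) ∈ S n
        · obtain ⟨n, hn⟩ := h
          have h1 : (0 : ℝ) ∈ ⋃ n, S n := Set.mem_iUnion.2 ⟨n, hn⟩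
          have h2 := hasSum_single (f := fun n => (if (0 : ℝ) ∈ S n then (1 : H →L[ℂ] H) else 0) φ) n
            (fun m hm => by
              have : (0 : ℝ) ∉ S m := fun h' => Set.disjoint_left.1 (hd hm) h' hn
              simp [this])
          simpa [h1, hn] using h2
        · have h1 : (0 : ℝ) ∉ ⋃ n, S n := by simpa using h
          push Not at h
          simp [h1, h] }

variable (E : ProjectionValuedMeasure H)

theorem re_inner_proj {S : Set ℝ} (hS : MeasurableSet S) (φ : H) :
    (⟪φ, E.proj S φ⟫_ℂ).re = ‖E.proj S φ‖ ^ 2 := by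
  have h := E.isStarProjection S hS
  have h1 : E.proj S (E.proj S φ) = E.proj S φ := by
    rw [← mul_apply_eq_comp, h.isIdempotentElem.eq]
  have h2 : ⟪φ, E.proj S (E.proj S φ)⟫_ℂ = ⟪E.proj S φ, E.proj S φ⟫_ℂ := by
    rw [← ContinuousLinearMap.adjoint_inner_left, ← ContinuousLinearMap.star_eq_adjoint,
      h.isSelfAdjoint.star_eq]
  rw [h1] at h2
  rw [h2, inner_self_eq_norm_sq_to_K]
  norm_cast

theorem proj_empty : E.proj ∅ = 0 := by
  ext φ
  have h := E.hasSum_proj (fun _ => ∅) (fun _ => MeasurableSet.empty)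
    (fun _ _ _ => by simp [Function.onFun]) φ
  simpa using h.summable.tendsto_atTop_zero

/-- The scalar spectral measure `μ_φ(S) = ⟨φ, E(S) φ⟩`, i.e. `d(φ, E_λ φ)`. -/
def scalarMeasure (φ : H) : Measure ℝ :=
  Measure.ofMeasurable (fun S _ => ENNReal.ofReal (⟪φ, E.proj S φ⟫_ℂ).re)
    (by simp [proj_empty])
    (fun S hS hd => by
      have h := (((innerSL ℂ φ).hasSum (E.hasSum_proj S hS hd φ)).mapL Complex.reCLM)
      simp only [innerSL_apply_apply, Complex.reCLM_apply] at h
      rw [← h.tsum_eq, ENNReal.ofReal_tsum_of_nonneg _ h.summable]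
      intro n
      rw [E.re_inner_proj (hS n)]
      positivity)

theorem scalarMeasure_apply (φ : H) {S : Set ℝ} (hS : MeasurableSet S) :
    E.scalarMeasure φ S = ENNReal.ofReal (⟪φ, E.proj S φ⟫_ℂ).re :=
  Measure.ofMeasurable_apply S hS

theorem scalarMeasure_eq_zero_iff (φ : H) {S : Set ℝ} (hS : MeasurableSet S) :
    E.scalarMeasure φ S = 0 ↔ E.proj S φ = 0 := by
  rw [scalarMeasure_apply E φ hS, E.re_inner_proj hS, ENNReal.ofReal_eq_zero]
  constructor
  · intro h
    exact norm_eq_zero.1 (pow_eq_zero_iff two_ne_zero |>.1 (le_antisymm h (by positivity)))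
  · intro h
    simp [h]

theorem absolutelyContinuous_iff (φ : H) :
    E.scalarMeasure φ ≪ volume ↔
      ∀ S : Set ℝ, MeasurableSet S → volume S = 0 → E.proj S φ = 0 := by
  constructor
  · intro h S hS h0
    exact (E.scalarMeasure_eq_zero_iff φ hS).1 (h h0)
  · intro h
    exact Measure.AbsolutelyContinuous.mk fun S hS h0 =>
      (E.scalarMeasure_eq_zero_iff φ hS).2 (h S hS h0)

/-- The absolutely continuous subspace: all `φ` whose scalar spectral measure is absolutely
continuous with respect to the Lebesgue measure. -/
def acSubspace : Submodule ℂ H where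
  carrier := {φ | E.scalarMeasure φ ≪ volume}
  zero_mem' := (E.absolutelyContinuous_iff 0).2 fun S _ _ => map_zero _
  add_mem' := fun {φ ψ} hφ hψ => (E.absolutelyContinuous_iff _).2 fun S hS h0 => by
    rw [map_add, (E.absolutelyContinuous_iff φ).1 hφ S hS h0,
      (E.absolutelyContinuous_iff ψ).1 hψ S hS h0, add_zero]
  smul_mem' := fun c φ hφ => (E.absolutelyContinuous_iff _).2 fun S hS h0 => by
    rw [map_smul, (E.absolutelyContinuous_iff φ).1 hφ S hS h0, smul_zero]

theorem isClosed_acSubspace : IsClosed (E.acSubspace : Set H) := by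
  have : (E.acSubspace : Set H) =
      ⋂ (S : Set ℝ) (_ : MeasurableSet S) (_ : volume S = 0), {φ | E.proj S φ = 0} := by
    ext φ
    simp only [Set.mem_iInter]
    exact E.absolutelyContinuous_iff φ
  rw [this]
  exact isClosed_iInter fun S => isClosed_iInter fun _ => isClosed_iInter fun _ =>
    isClosed_eq (E.proj S).continuous continuous_const

instance : CompleteSpace E.acSubspace := E.isClosed_acSubspace.completeSpace_coe

/-- The orthogonal projection onto the absolutely continuous subspace. -/
def acProj : H →L[ℂ] H := E.acSubspace.starProjection

open Classical in
/-- The spectral integral `∫ f(λ) dE_λ` of a bounded Borel function `f`: the unique bounded operator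
`T` with `⟨φ, T φ⟩ = ∫ f(λ) d(φ, E_λ φ)` for all `φ`. (It exists for every bounded Borel `f`; where
there is no such operator the value is `0`.) -/
def integral (f : ℝ → ℂ) : H →L[ℂ] H :=
  if h : ∃ T : H →L[ℂ] H, ∀ φ : H, ⟪φ, T φ⟫_ℂ = ∫ x, f x ∂(E.scalarMeasure φ)
  then h.choose else 0

end ProjectionValuedMeasure

/-! ### The spectral measure of a self-adjoint operator -/

/-- `B = ∫ λ dE_λ`: the domain of `B` consists of all `φ` with `∫ λ² d(φ, E_λ φ) < ∞`, and
`⟨φ, B φ⟩ = ∫ λ d(φ, E_λ φ)` there. -/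
def IsSpectralMeasure (B : H →ₗ.[ℂ] H) (E : ProjectionValuedMeasure H) : Prop :=
  (∀ φ : H, φ ∈ B.domain ↔ ∫⁻ x, ENNReal.ofReal (x ^ 2) ∂(E.scalarMeasure φ) < ∞) ∧
    ∀ φ : B.domain, ⟪(φ : H), B φ⟫_ℂ = ∫ x, (x : ℂ) ∂(E.scalarMeasure (φ : H))

open Classical in
/-- The spectral measure `E` of `B`; by the spectral theorem every self-adjoint operator has exactly
one. (The value for operators that have none is irrelevant.) -/
def spectralMeasure (B : H →ₗ.[ℂ] H) : ProjectionValuedMeasure H :=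
  if h : ∃ E : ProjectionValuedMeasure H, IsSpectralMeasure B E then h.choose else default

/-- The unitary group `e^{iBt} = ∫ e^{iλt} dE_λ` of a self-adjoint operator `B`. -/
def expI (B : H →ₗ.[ℂ] H) (t : ℝ) : H →L[ℂ] H :=
  (spectralMeasure B).integral fun x => Complex.exp (Complex.I * x * t)

/-- `P_ac(B)`, the projection onto the absolutely continuous subspace of `B`. -/
def Pac (B : H →ₗ.[ℂ] H) : H →L[ℂ] H := (spectralMeasure B).acProj

/-- The set `𝓜(B)` of all `φ` with `d(φ, E_λ φ) = |f(λ)|² dλ` for some `f ∈ L^∞(ℝ)`. -/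
def boundedDensitySet (B : H →ₗ.[ℂ] H) : Set H :=
  {φ | ∃ f : ℝ → ℂ, MemLp f ∞ volume ∧
    (spectralMeasure B).scalarMeasure φ = volume.withDensity fun x => ‖f x‖ₑ ^ 2}

end Scattering

end

set_option linter.unusedSectionVars false

noncomputable section

namespace Scattering

variable {H : Type*} [NormedAddCommGroup H] [InnerProductSpace ℂ H] [CompleteSpace H]

/-! ### Quadratic forms and weak limits of bounded operators -/

/-! Let R_A, R_B be the resolvents at z, C = K R_B − R_A K = C₁ + C₂ and J = R_A K R_B. Since A R_A
= 1 + z R_A, and likewise for B, formally AJ − JB = C. Hence y(t) = e^{iAt} J e^{-iBt} φ is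
differentiable for every φ, with y'(t) = i e^{iAt} C e^{-iBt} φ; the smoothing by resolvents removes
all domain questions.

For φ in M, convergence of y is Pearson's argument (`exists_tendsto_orbit`). Put Δ(a) = y(t+a) −
y(s+a). Since y' → 0, also Δ(a) → 0, so ‖y(t) − y(s)‖² is at most 2∫₀^∞ |⟨Δ, Δ'⟩|. The contribution
of C₂ is bounded by tails of ∫‖C₂ e^{-iBr} φ‖ dr. Write C₁ = GS with G, S Hilbert–Schmidt
(`IsTraceClass.exists_mul`). For p ∈ {t, s}, moving e^{iA(p+a)} G across the inner product pairs
terms G⋆ e^{iAτ} J e^{-iB(r+a)} φ with S e^{-iB(p+a)} φ, where r ∈ {t, s} and τ = r − p does not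
depend on a. Both are square integrable in a, by Plancherel and the bounded spectral density of φ
(`exists_lintegral_inner_group_le`). The L² norm of the first is bounded uniformly in τ, and that of
the second is a tail, so y is Cauchy.

M is dense in 𝓜(B), and 𝓜(B) is dense in the absolutely continuous subspace, so the limit for J
exists on that whole subspace. K is then recovered from e^{iAt} K e^{-iBt} R_B² ψ = e^{iAt} J
e^{-iBt} ψ + e^{iAt} C e^{-iBt} R_B ψ: the last term tends to 0 (Riemann–Lebesgue for C₁, the
hypothesis for C₂), and the vectors R_B² ψ are dense in the absolutely continuous subspace.

The groups are defined through a chosen spectral measure, so the spectral theorem itself has to be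
proved. The resolvent is a bounded normal operator; its continuous functional calculus gives Riesz
measures on the spectrum, which yield projections for Borel sets and are carried to the line by y ↦
1/y + z. Afterwards only the two defining properties in `IsSpectralMeasure` are used, together with
quadratic forms and polarization. -/

theorem inner_map_map_polarization {V : Type*} [AddCommGroup V] [Module ℂ V]
    (S T : V →ₗ[ℂ] H) (x y : V) :
    ⟪S x, T y⟫_ℂ = (⟪S (x + y), T (x + y)⟫_ℂ - ⟪S (x - y), T (x - y)⟫_ℂ
      - Complex.I * ⟪S (x + Complex.I • y), T (x + Complex.I • y)⟫_ℂ
      + Complex.I * ⟪S (x - Complex.I • y), T (x - Complex.I • y)⟫_ℂ) / 4 := by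
  simp only [map_add, map_sub, map_smul, inner_add_left, inner_add_right, inner_sub_left,
    inner_sub_right, inner_smul_left, inner_smul_right, Complex.conj_I]
  ring_nf
  simp only [Complex.I_sq]
  ring

/-- Vectors range over an arbitrary complex space V, so that polarization also applies on the domain
of an unbounded operator and on the absolutely continuous subspace. -/
theorem inner_map_eq_zero_of_forall_self {V : Type*} [AddCommGroup V] [Module ℂ V]
    {S T : V →ₗ[ℂ] H} (h : ∀ x, ⟪S x, T x⟫_ℂ = 0) (x y : V) : ⟪S x, T y⟫_ℂ = 0 := by
  simp only [inner_map_map_polarization S T x y, h, sub_zero, mul_zero, add_zero, zero_div]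

theorem tendsto_inner_map_of_forall_self {V ι : Type*} [AddCommGroup V] [Module ℂ V]
    {l : Filter ι} {S : V →ₗ[ℂ] H} {T : ι → V →ₗ[ℂ] H} {T₀ : V →ₗ[ℂ] H}
    (h : ∀ x, Tendsto (fun i => ⟪S x, T i x⟫_ℂ) l (𝓝 ⟪S x, T₀ x⟫_ℂ)) (x y : V) :
    Tendsto (fun i => ⟪S x, T i y⟫_ℂ) l (𝓝 ⟪S x, T₀ y⟫_ℂ) := by
  rw [inner_map_map_polarization]
  simp_rw [fun i => inner_map_map_polarization S (T i) x y]
  exact (((((h _).sub (h _)).sub ((h _).const_mul _)).add ((h _).const_mul _)).div_const _)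

/-- Polarization and the parallelogram law bound ⟨x, Ty⟩ by c(‖x‖² + ‖y‖²); the factor 2 appears on
taking ‖x‖ = ‖y‖. -/
theorem norm_le_of_forall_norm_inner_self_le {T : H →L[ℂ] H} {c : ℝ}
    (h : ∀ φ, ‖⟪φ, T φ⟫_ℂ‖ ≤ c * ‖φ‖ ^ 2) (hc : 0 ≤ c) : ‖T‖ ≤ 2 * c := by
  have key (x y : H) : ‖⟪x, T y⟫_ℂ‖ ≤ c * (‖x‖ ^ 2 + ‖y‖ ^ 2) := by
    have e := inner_map_map_polarization (LinearMap.id : H →ₗ[ℂ] H) (T : H →ₗ[ℂ] H) x y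
    simp only [LinearMap.id_coe, id_eq, ContinuousLinearMap.coe_coe] at e
    rw [e, norm_div]
    have p1 := parallelogram_law_with_norm ℂ x y
    have p2 := parallelogram_law_with_norm ℂ x (Complex.I • y)
    rw [norm_smul, Complex.norm_I, one_mul] at p2
    have h4 : ‖(4 : ℂ)‖ = 4 := by simp
    rw [h4, div_le_iff₀ (by norm_num)]
    refine (norm_add_le _ _).trans ?_
    rw [norm_mul, Complex.norm_I, one_mul]
    have := (norm_sub_le (⟪x + y, T (x + y)⟫_ℂ - ⟪x - y, T (x - y)⟫_ℂ)
      (Complex.I * ⟪x + Complex.I • y, T (x + Complex.I • y)⟫_ℂ)).trans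
        (add_le_add_left (norm_sub_le _ _) _)
    rw [norm_mul, Complex.norm_I, one_mul] at this
    nlinarith [h (x + y), h (x - y), h (x + Complex.I • y), h (x - Complex.I • y)]
  refine ContinuousLinearMap.opNorm_le_bound _ (by positivity) fun y => ?_
  by_cases hy : T y = 0
  · rw [hy, norm_zero]; positivity
  have hy' : 0 < ‖T y‖ := norm_pos_iff.2 hy
  -- The test vector is Ty rescaled to the norm of y.
  have := key (((‖y‖ / ‖T y‖ : ℝ) : ℂ) • T y) y
  rw [inner_smul_left, inner_self_eq_norm_sq_to_K, norm_smul, norm_mul] at this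
  simp only [Complex.conj_ofReal, Complex.norm_real, Complex.coe_algebraMap, norm_pow, norm_div,
    norm_norm] at this
  rw [div_mul_cancel₀ _ hy'.ne'] at this
  have e : ‖y‖ / ‖T y‖ * ‖T y‖ ^ 2 = ‖y‖ * ‖T y‖ := by field_simp
  rw [e] at this
  have hyy : 0 < ‖y‖ := norm_pos_iff.2 (fun h0 => hy (by simp [h0]))
  nlinarith

/-- By polarization all matrix elements converge; the limit is a bounded sesquilinear form, which
Fréchet–Riesz represents by an operator. -/
theorem exists_weak_limit {T : ℕ → H →L[ℂ] H} {c : ℝ} (hT : ∀ n, ‖T n‖ ≤ c)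
    (hl : ∀ φ, ∃ l, Tendsto (fun n => ⟪φ, T n φ⟫_ℂ) atTop (𝓝 l)) :
    ∃ T₀ : H →L[ℂ] H, ∀ ψ φ, Tendsto (fun n => ⟪ψ, T n φ⟫_ℂ) atTop (𝓝 ⟪ψ, T₀ φ⟫_ℂ) := by
  have h1 (v w : H) : ∃ l, Tendsto (fun n => ⟪T n v, w⟫_ℂ) atTop (𝓝 l) := by
    have e (n : ℕ) : ⟪T n v, w⟫_ℂ = starRingEnd ℂ ⟪w, T n v⟫_ℂ := (inner_conj_symm _ _).symm
    obtain ⟨a, ha⟩ := hl (w + v)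
    obtain ⟨b, hb⟩ := hl (w - v)
    obtain ⟨p, hp⟩ := hl (w + Complex.I • v)
    obtain ⟨q, hq⟩ := hl (w - Complex.I • v)
    have := ((((ha.sub hb).sub (hp.const_mul Complex.I)).add (hq.const_mul Complex.I)).div_const 4)
    refine ⟨_, ((Complex.continuous_conj.tendsto _).comp this).congr fun n => ?_⟩
    rw [e]
    simp only [Function.comp_apply]
    congr 1
    exact (inner_map_map_polarization (LinearMap.id : H →ₗ[ℂ] H) (T n : H →ₗ[ℂ] H) w v).symm
  choose L hL using h1
  let F : H →ₗ⋆[ℂ] H →ₗ[ℂ] ℂ := LinearMap.mk₂'ₛₗ (starRingEnd ℂ) (RingHom.id ℂ) L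
    (fun v v' w => tendsto_nhds_unique (hL _ _) (((hL v w).add (hL v' w)).congr fun n => by
      simp))
    (fun a v w => tendsto_nhds_unique (hL _ _) (((hL v w).const_mul (starRingEnd ℂ a)).congr
      fun n => by simp [mul_comm]))
    (fun v w w' => tendsto_nhds_unique (hL _ _) (((hL v w).add (hL v w')).congr fun n => by
      simp))
    (fun a v w => tendsto_nhds_unique (hL _ _) (((hL v w).const_mul a).congr
      fun n => by simp))
  let F' : H →L⋆[ℂ] H →L[ℂ] ℂ := F.mkContinuous₂ c (fun v w => by
    refine le_of_tendsto (hL v w).norm (Eventually.of_forall fun n => ?_)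
    calc ‖⟪T n v, w⟫_ℂ‖ ≤ ‖T n v‖ * ‖w‖ := norm_inner_le_norm _ _
      _ ≤ c * ‖v‖ * ‖w‖ := by gcongr; exact (T n).le_of_opNorm_le (hT n) v)
  refine ⟨InnerProductSpace.continuousLinearMapOfBilin F', fun ψ φ => ?_⟩
  have e : ⟪ψ, InnerProductSpace.continuousLinearMapOfBilin F' φ⟫_ℂ
      = starRingEnd ℂ (L φ ψ) := by
    rw [← inner_conj_symm, InnerProductSpace.continuousLinearMapOfBilin_apply]
    rfl
  rw [e]
  refine ((Complex.continuous_conj.tendsto _).comp (hL φ ψ)).congr fun n => ?_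
  exact inner_conj_symm _ _

/-! ### Operators given by integrals of scalar measures -/

section HasForm

variable {X : Type*} [MeasurableSpace X]

/-- `T` is the operator with quadratic form `φ ↦ ∫ f dμ_φ`. -/
def HasForm (μ : H → Measure X) (f : X → ℂ) (T : H →L[ℂ] H) : Prop :=
  ∀ φ : H, ⟪φ, T φ⟫_ℂ = ∫ x, f x ∂(μ φ)

variable {μ : H → Measure X} {f g : X → ℂ} {S T : H →L[ℂ] H}

theorem HasForm.unique (hS : HasForm μ f S) (hT : HasForm μ f T) : S = T := by
  have : (S : H →ₗ[ℂ] H) = T := (ext_inner_map _ _).1 fun x => by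
    rw [← inner_conj_symm, ← inner_conj_symm (_ : H) x]
    exact congrArg _ ((hS x).trans (hT x).symm)
  exact ContinuousLinearMap.coe_injective this

theorem isFiniteMeasure_of_univ (hμ : ∀ φ, μ φ Set.univ = ENNReal.ofReal (‖φ‖ ^ 2)) (φ : H) :
    IsFiniteMeasure (μ φ) := ⟨by rw [hμ]; exact ENNReal.ofReal_lt_top⟩

/-- Bounded measurable functions. -/
structure IsBddMeasurable (f : X → ℂ) : Prop where
  measurable : Measurable f
  bounded : ∃ c : ℝ, ∀ x, ‖f x‖ ≤ c

namespace IsBddMeasurable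

theorem const (a : ℂ) : IsBddMeasurable (fun _ : X => a) := ⟨measurable_const, ‖a‖, fun _ => le_rfl⟩

theorem add (hf : IsBddMeasurable f) (hg : IsBddMeasurable g) :
    IsBddMeasurable (fun x => f x + g x) := by
  obtain ⟨c, hc⟩ := hf.bounded
  obtain ⟨d, hd⟩ := hg.bounded
  exact ⟨hf.measurable.add hg.measurable, c + d, fun x =>
    (norm_add_le _ _).trans (add_le_add (hc x) (hd x))⟩

theorem mul (hf : IsBddMeasurable f) (hg : IsBddMeasurable g) :
    IsBddMeasurable (fun x => f x * g x) := by
  obtain ⟨c, hc⟩ := hf.bounded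
  obtain ⟨d, hd⟩ := hg.bounded
  refine ⟨hf.measurable.mul hg.measurable, c * d, fun x => ?_⟩
  rw [norm_mul]
  exact mul_le_mul (hc x) (hd x) (norm_nonneg _) ((norm_nonneg _).trans (hc x))

theorem conj (hf : IsBddMeasurable f) : IsBddMeasurable (fun x => starRingEnd ℂ (f x)) := by
  obtain ⟨c, hc⟩ := hf.bounded
  exact ⟨Complex.continuous_conj.measurable.comp hf.measurable, c, fun x => by simpa using hc x⟩

theorem indicator (hf : IsBddMeasurable f) {s : Set X} (hs : MeasurableSet s) :
    IsBddMeasurable (s.indicator f) := by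
  obtain ⟨c, hc⟩ := hf.bounded
  exact ⟨hf.measurable.indicator hs, c, fun x => (norm_indicator_le_norm_self _ _).trans (hc x)⟩

theorem integrable (hf : IsBddMeasurable f) (ν : Measure X) [IsFiniteMeasure ν] :
    Integrable f ν := by
  obtain ⟨c, hc⟩ := hf.bounded
  exact Integrable.of_bound hf.measurable.aestronglyMeasurable c (Eventually.of_forall hc)

/-- A property of bounded measurable functions that holds for multiples of indicators and is stable
under sums and bounded pointwise limits holds for all bounded measurable functions. -/
theorem induction {P : (X → ℂ) → Prop}
    (ind : ∀ (a : ℂ) (s : Set X), MeasurableSet s → P (s.indicator fun _ => a))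
    (sum : ∀ f g, IsBddMeasurable f → IsBddMeasurable g → P f → P g → P fun x => f x + g x)
    (lim : ∀ (F : ℕ → X → ℂ) (f : X → ℂ) (c : ℝ), (∀ n, Measurable (F n)) →
      (∀ n x, ‖F n x‖ ≤ c) → (∀ x, Tendsto (fun n => F n x) atTop (𝓝 (f x))) → (∀ n, P (F n)) →
      P f)
    (hf : IsBddMeasurable f) : P f := by
  have simple (s : SimpleFunc X ℂ) : P s := by
    have hb (s : SimpleFunc X ℂ) : IsBddMeasurable (s : X → ℂ) :=
      ⟨s.measurable, s.exists_forall_norm_le⟩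
    induction s using SimpleFunc.induction with
    | @const a s hs =>
      convert ind a _ hs using 1
      ext x
      by_cases hx : x ∈ s <;> simp [SimpleFunc.coe_piecewise, hx]
    | add _ h h' => exact sum _ _ (hb _) (hb _) h h'
  obtain ⟨c, hc⟩ := hf.bounded
  have hm := hf.measurable.stronglyMeasurable
  refine lim (fun n => hm.approxBounded |c| n) f |c| (fun n => SimpleFunc.measurable _)
    (fun n x => hm.norm_approxBounded_le (abs_nonneg c) n x) (fun x =>
      hm.tendsto_approxBounded_of_norm_le ((hc x).trans (le_abs_self c))) fun n => simple _

end IsBddMeasurable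

theorem HasForm.norm_le (hμ : ∀ φ, μ φ Set.univ = ENNReal.ofReal (‖φ‖ ^ 2))
    (h : HasForm μ f T) {c : ℝ} (hc : 0 ≤ c) (hf : ∀ x, ‖f x‖ ≤ c) : ‖T‖ ≤ 2 * c := by
  refine norm_le_of_forall_norm_inner_self_le (fun φ => ?_) hc
  have := isFiniteMeasure_of_univ hμ φ
  rw [h φ]
  refine (norm_integral_le_of_norm_le_const (Eventually.of_forall hf)).trans_eq ?_
  rw [measureReal_def, hμ, ENNReal.toReal_ofReal (by positivity)]

theorem HasForm.one (hμ : ∀ φ, μ φ Set.univ = ENNReal.ofReal (‖φ‖ ^ 2)) :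
    HasForm μ (fun _ => 1) 1 := fun φ => by
  rw [integral_const, measureReal_def, hμ, ENNReal.toReal_ofReal (by positivity)]
  simp [inner_self_eq_norm_sq_to_K]

theorem HasForm.add (hμ : ∀ φ, μ φ Set.univ = ENNReal.ofReal (‖φ‖ ^ 2))
    (hf : IsBddMeasurable f) (hg : IsBddMeasurable g) (hS : HasForm μ f S) (hT : HasForm μ g T) :
    HasForm μ (fun x => f x + g x) (S + T) := fun φ => by
  have := isFiniteMeasure_of_univ hμ φ
  rw [integral_add (hf.integrable _) (hg.integrable _), ← hS, ← hT, add_apply, inner_add_right]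

theorem HasForm.const_mul (a : ℂ) (hT : HasForm μ f T) :
    HasForm μ (fun x => a * f x) (a • T) := fun φ => by
  rw [integral_const_mul, ← hT, smul_apply, inner_smul_right]

theorem HasForm.conj (hT : HasForm μ f T) :
    HasForm μ (fun x => starRingEnd ℂ (f x)) (star T) := fun φ => by
  rw [integral_conj, ← hT, inner_conj_symm, ContinuousLinearMap.star_eq_adjoint,
    ContinuousLinearMap.adjoint_inner_right]

theorem HasForm.tendsto_integral (hμ : ∀ φ, μ φ Set.univ = ENNReal.ofReal (‖φ‖ ^ 2))
    {F : ℕ → X → ℂ} {c : ℝ}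
    (hFm : ∀ n, Measurable (F n)) (hF : ∀ n x, ‖F n x‖ ≤ c)
    (hlim : ∀ x, Tendsto (fun n => F n x) atTop (𝓝 (f x))) (φ : H) :
    Tendsto (fun n => ∫ x, F n x ∂(μ φ)) atTop (𝓝 (∫ x, f x ∂(μ φ))) := by
  have := isFiniteMeasure_of_univ hμ φ
  exact tendsto_integral_of_dominated_convergence (fun _ => c)
    (fun n => (hFm n).aestronglyMeasurable) (integrable_const c)
    (fun n => Eventually.of_forall (hF n)) (Eventually.of_forall hlim)

/-- Dominated convergence makes the quadratic forms converge, and the uniform bound on the operators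
supplies a weak limit. This is the limit step of every monotone class argument below. -/
theorem exists_hasForm_of_tendsto (hμ : ∀ φ, μ φ Set.univ = ENNReal.ofReal (‖φ‖ ^ 2))
    {F : ℕ → X → ℂ} {c : ℝ} (hFm : ∀ n, Measurable (F n)) (hF : ∀ n x, ‖F n x‖ ≤ c)
    (hlim : ∀ x, Tendsto (fun n => F n x) atTop (𝓝 (f x)))
    (hT : ∀ n, ∃ T, HasForm μ (F n) T) : ∃ T, HasForm μ f T := by
  choose T hT using hT
  have hF' n x : ‖F n x‖ ≤ |c| := (hF n x).trans (le_abs_self c)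
  obtain ⟨T₀, h₀⟩ := exists_weak_limit (fun n => (hT n).norm_le hμ (abs_nonneg c) (hF' n))
    (fun φ => ⟨_, by simpa only [hT _ φ] using HasForm.tendsto_integral hμ hFm hF hlim φ⟩)
  refine ⟨T₀, fun φ => tendsto_nhds_unique (h₀ φ φ) ?_⟩
  simpa only [hT _ φ] using HasForm.tendsto_integral hμ hFm hF hlim φ

theorem HasForm.tendsto_inner (hμ : ∀ φ, μ φ Set.univ = ENNReal.ofReal (‖φ‖ ^ 2))
    {F : ℕ → X → ℂ} {c : ℝ} {Tn : ℕ → H →L[ℂ] H} (hFm : ∀ n, Measurable (F n))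
    (hF : ∀ n x, ‖F n x‖ ≤ c) (hlim : ∀ x, Tendsto (fun n => F n x) atTop (𝓝 (f x)))
    (hTn : ∀ n, HasForm μ (F n) (Tn n)) (hT : HasForm μ f T) (ψ φ : H) :
    Tendsto (fun n => ⟪ψ, Tn n φ⟫_ℂ) atTop (𝓝 ⟪ψ, T φ⟫_ℂ) := by
  refine tendsto_inner_map_of_forall_self (S := LinearMap.id) (T := fun n => (Tn n : H →ₗ[ℂ] H))
    (T₀ := (T : H →ₗ[ℂ] H)) (fun x => ?_) ψ φ
  simpa [hT x, hTn _ x] using HasForm.tendsto_integral hμ hFm hF hlim x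

/-- If `Φ(f) Q` has form `f g` for bounded pointwise convergent sequences, so it does in the
limit. -/
theorem HasForm.mul_of_tendsto (hμ : ∀ φ, μ φ Set.univ = ENNReal.ofReal (‖φ‖ ^ 2))
    {F : ℕ → X → ℂ} {c : ℝ} {Tn : ℕ → H →L[ℂ] H} {Q : H →L[ℂ] H} (hg : IsBddMeasurable g)
    (hFm : ∀ n, Measurable (F n))
    (hF : ∀ n x, ‖F n x‖ ≤ c) (hlim : ∀ x, Tendsto (fun n => F n x) atTop (𝓝 (f x)))
    (hTn : ∀ n, HasForm μ (F n) (Tn n)) (hT : HasForm μ f T)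
    (hQ : ∀ n, HasForm μ (fun x => F n x * g x) (Tn n * Q)) :
    HasForm μ (fun x => f x * g x) (T * Q) := fun φ => by
  obtain ⟨d, hd⟩ := hg.bounded
  refine tendsto_nhds_unique (HasForm.tendsto_inner hμ hFm hF hlim hTn hT φ (Q φ)) ?_
  have := HasForm.tendsto_integral (f := fun x => f x * g x) (c := c * d) hμ
    (fun n => (hFm n).mul hg.measurable) (fun n x => ?_)
    (fun x => (hlim x).mul_const _) φ
  · exact this.congr fun n => (hQ n φ).symm
  · simp only [Pi.mul_apply, norm_mul]
    exact mul_le_mul (hF n x) (hd x) (norm_nonneg _) ((norm_nonneg _).trans (hF n x))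

end HasForm

/-! ### Bounded Borel functional calculus of a projection-valued measure. -/

namespace ProjectionValuedMeasure

variable (E : ProjectionValuedMeasure H) {f g : ℝ → ℂ}

theorem scalarMeasure_univ (φ : H) :
    E.scalarMeasure φ Set.univ = ENNReal.ofReal (‖φ‖ ^ 2) := by
  rw [E.scalarMeasure_apply φ MeasurableSet.univ, E.re_inner_proj MeasurableSet.univ, E.proj_univ]
  rfl

instance (φ : H) : IsFiniteMeasure (E.scalarMeasure φ) :=
  isFiniteMeasure_of_univ E.scalarMeasure_univ φ

theorem star_proj {S : Set ℝ} (hS : MeasurableSet S) : star (E.proj S) = E.proj S :=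
  (E.isStarProjection S hS).isSelfAdjoint.star_eq

theorem hasForm_indicator (a : ℂ) {S : Set ℝ} (hS : MeasurableSet S) :
    HasForm E.scalarMeasure (S.indicator fun _ => a) (a • E.proj S) := fun φ => by
  rw [integral_indicator_const _ hS, measureReal_def, E.scalarMeasure_apply φ hS,
    ENNReal.toReal_ofReal (by rw [E.re_inner_proj hS]; positivity), smul_apply, inner_smul_right]
  have : ((⟪φ, E.proj S φ⟫_ℂ).re : ℂ) = ⟪φ, E.proj S φ⟫_ℂ := by
    rw [← Complex.conj_eq_iff_re, inner_conj_symm]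
    conv_rhs => rw [← E.star_proj hS, ContinuousLinearMap.star_eq_adjoint,
      ContinuousLinearMap.adjoint_inner_right]
  rw [Complex.real_smul, this, mul_comm]

theorem exists_hasForm (hf : IsBddMeasurable f) : ∃ T, HasForm E.scalarMeasure f T := by
  refine IsBddMeasurable.induction (P := fun f => ∃ T, HasForm E.scalarMeasure f T)
    (fun a S hS => ⟨_, E.hasForm_indicator a hS⟩) ?_ ?_ hf
  · rintro f g hf hg ⟨S, hS⟩ ⟨T, hT⟩
    exact ⟨_, hS.add E.scalarMeasure_univ hf hg hT⟩
  · intro F f c hFm hF hlim h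
    exact exists_hasForm_of_tendsto E.scalarMeasure_univ hFm hF hlim h

theorem hasForm_integral (hf : IsBddMeasurable f) :
    HasForm E.scalarMeasure f (E.integral f) := by
  have h := E.exists_hasForm hf
  unfold integral
  exact (dif_pos h).symm ▸ h.choose_spec

theorem integral_eq (hf : IsBddMeasurable f) {T : H →L[ℂ] H} (hT : HasForm E.scalarMeasure f T) :
    E.integral f = T :=
  (E.hasForm_integral hf).unique hT

theorem isBddMeasurable_of_tendsto {F : ℕ → ℝ → ℂ} {c : ℝ} (hFm : ∀ n, Measurable (F n))
    (hF : ∀ n x, ‖F n x‖ ≤ c) (hlim : ∀ x, Tendsto (fun n => F n x) atTop (𝓝 (f x))) :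
    IsBddMeasurable f :=
  ⟨measurable_of_tendsto_metrizable hFm (tendsto_pi_nhds.2 hlim), c, fun x =>
    le_of_tendsto (hlim x).norm (Eventually.of_forall fun n => hF n x)⟩

/-- Multiplicativity in the first factor follows from multiplicativity for indicators. -/
theorem hasForm_mul_of_proj (hf : IsBddMeasurable f) (hg : IsBddMeasurable g) {Q : H →L[ℂ] H}
    (hQ : ∀ S, MeasurableSet S →
      HasForm E.scalarMeasure (fun x => S.indicator (fun _ => 1) x * g x) (E.proj S * Q)) :
    HasForm E.scalarMeasure (fun x => f x * g x) (E.integral f * Q) := by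
  have h : IsBddMeasurable f ∧
      HasForm E.scalarMeasure (fun x => f x * g x) (E.integral f * Q) := by
    refine IsBddMeasurable.induction (P := fun f => IsBddMeasurable f ∧
      HasForm E.scalarMeasure (fun x => f x * g x) (E.integral f * Q)) ?_ ?_ ?_ hf
    · intro a S hS
      have hb := (IsBddMeasurable.const a).indicator hS
      refine ⟨hb, ?_⟩
      rw [E.integral_eq hb (E.hasForm_indicator a hS), smul_mul_assoc]
      convert (hQ S hS).const_mul a using 2 with x
      by_cases hx : x ∈ S <;> simp [hx]
    · rintro f₁ f₂ h₁ h₂ ⟨-, h₁'⟩ ⟨-, h₂'⟩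
      refine ⟨h₁.add h₂, ?_⟩
      rw [E.integral_eq (h₁.add h₂) ((E.hasForm_integral h₁).add E.scalarMeasure_univ h₁ h₂
        (E.hasForm_integral h₂)), add_mul]
      convert h₁'.add E.scalarMeasure_univ (h₁.mul hg) (h₂.mul hg) h₂' using 2 with x
      ring
    · intro F f c hFm hF hlim h
      have hb := isBddMeasurable_of_tendsto hFm hF hlim
      exact ⟨hb, HasForm.mul_of_tendsto E.scalarMeasure_univ hg hFm hF hlim
        (fun n => E.hasForm_integral (h n).1) (E.hasForm_integral hb) fun n => (h n).2⟩
  exact h.2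

theorem integral_conj (hf : IsBddMeasurable f) :
    E.integral (fun x => starRingEnd ℂ (f x)) = star (E.integral f) :=
  E.integral_eq hf.conj (E.hasForm_integral hf).conj

theorem integral_add (hf : IsBddMeasurable f) (hg : IsBddMeasurable g) :
    E.integral (fun x => f x + g x) = E.integral f + E.integral g :=
  E.integral_eq (hf.add hg)
    ((E.hasForm_integral hf).add E.scalarMeasure_univ hf hg (E.hasForm_integral hg))

theorem integral_const_mul (a : ℂ) (hf : IsBddMeasurable f) :
    E.integral (fun x => a * f x) = a • E.integral f :=
  E.integral_eq ((IsBddMeasurable.const a).mul hf) ((E.hasForm_integral hf).const_mul a)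

theorem integral_one : E.integral (fun _ => 1) = 1 :=
  E.integral_eq (IsBddMeasurable.const 1) (HasForm.one E.scalarMeasure_univ)

theorem integral_indicator_one {S : Set ℝ} (hS : MeasurableSet S) :
    E.integral (S.indicator fun _ => 1) = E.proj S :=
  E.integral_eq ((IsBddMeasurable.const 1).indicator hS) (by
    simpa using E.hasForm_indicator 1 hS)

theorem hasForm_mul_proj (hf : IsBddMeasurable f) {S : Set ℝ} (hS : MeasurableSet S) :
    HasForm E.scalarMeasure (fun x => f x * S.indicator (fun _ => 1) x)
      (E.integral f * E.proj S) := by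
  refine E.hasForm_mul_of_proj hf ((IsBddMeasurable.const 1).indicator hS) fun S' hS' => ?_
  rw [← E.proj_inter S' S hS' hS]
  convert E.hasForm_indicator 1 (hS'.inter hS) using 1
  · ext x
    by_cases h : x ∈ S <;> by_cases h' : x ∈ S' <;> simp [h, h']
  · simp

/-- For two indicators this is the intersection property of E. Extending the left factor, taking
adjoints to exchange the factors, and extending again gives the general case. -/
theorem integral_mul (hf : IsBddMeasurable f) (hg : IsBddMeasurable g) :
    E.integral (fun x => f x * g x) = E.integral f * E.integral g := by
  refine E.integral_eq (hf.mul hg) (E.hasForm_mul_of_proj hf hg fun S hS => ?_)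
  have h := (E.hasForm_mul_proj hg.conj hS).conj
  rw [star_mul, E.star_proj hS, E.integral_conj hg, star_star] at h
  convert h using 2 with x
  by_cases hx : x ∈ S <;> simp [hx]

theorem norm_sq_integral_apply (hf : IsBddMeasurable f) (φ : H) :
    ‖E.integral f φ‖ ^ 2 = ∫ x, ‖f x‖ ^ 2 ∂(E.scalarMeasure φ) := by
  have h := E.hasForm_integral (hf.conj.mul hf) φ
  rw [E.integral_mul hf.conj hf, E.integral_conj hf, ContinuousLinearMap.star_eq_adjoint,
    mul_apply_eq_comp, ContinuousLinearMap.adjoint_inner_right,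
    inner_self_eq_norm_sq_to_K] at h
  have e : ∀ x, starRingEnd ℂ (f x) * f x = ((‖f x‖ ^ 2 : ℝ) : ℂ) := fun x => by
    rw [Complex.conj_mul', Complex.ofReal_pow]
  simp_rw [e] at h
  rw [integral_complex_ofReal] at h
  refine Complex.ofReal_injective (Eq.trans ?_ h)
  simp

theorem lintegral_enorm_sq (hf : IsBddMeasurable f) (φ : H) :
    ‖E.integral f φ‖ₑ ^ 2 = ∫⁻ x, ‖f x‖ₑ ^ 2 ∂(E.scalarMeasure φ) := by
  have hi : Integrable (fun x => ‖f x‖ ^ 2) (E.scalarMeasure φ) := by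
    simpa using ((hf.conj.mul hf).integrable (E.scalarMeasure φ)).norm.congr
      (Eventually.of_forall fun x => by simp [sq])
  rw [← ofReal_norm, ← ENNReal.ofReal_pow (norm_nonneg _), E.norm_sq_integral_apply hf φ,
    ofReal_integral_eq_lintegral_ofReal hi (Eventually.of_forall fun x => by positivity)]
  refine lintegral_congr fun x => ?_
  rw [← ofReal_norm, ← ENNReal.ofReal_pow (norm_nonneg _)]

theorem enorm_sq_proj (φ : H) {S : Set ℝ} (hS : MeasurableSet S) :
    ‖E.proj S φ‖ₑ ^ 2 = E.scalarMeasure φ S := by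
  rw [E.scalarMeasure_apply φ hS, E.re_inner_proj hS, ← ofReal_norm,
    ← ENNReal.ofReal_pow (norm_nonneg _)]

/-- The projection E(S) absorbs into the integral as the factor 1_S, and the norm square of a
spectral integral is the integral of |1_S f|². -/
theorem scalarMeasure_integral_apply (hf : IsBddMeasurable f) (φ : H) :
    E.scalarMeasure (E.integral f φ) =
      (E.scalarMeasure φ).withDensity fun x => ‖f x‖ₑ ^ 2 := by
  ext S hS
  rw [← E.enorm_sq_proj _ hS, withDensity_apply _ hS, ← E.integral_indicator_one hS,
    ← mul_apply_eq_comp, ← E.integral_mul ((IsBddMeasurable.const 1).indicator hS) hf,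
    E.lintegral_enorm_sq (((IsBddMeasurable.const 1).indicator hS).mul hf),
    ← lintegral_indicator hS]
  refine lintegral_congr fun x => ?_
  by_cases hx : x ∈ S <;> simp [hx]

end ProjectionValuedMeasure

/-! ### Spectral measures of bounded normal operators -/

section Normal

variable {R : H →L[ℂ] H}

/-- The real continuous functional calculus on the spectrum, tested on a vector. -/
def cfcFunctional (hR : IsStarNormal R) (φ : H) :
    CompactlySupportedContinuousMap (spectrum ℂ R) ℝ →ₚ[ℝ] ℝ :=
  PositiveLinearMap.mk₀
    { toFun := fun g => (⟪φ, cfcHom hR ⟨fun y => (g y : ℂ), by fun_prop⟩ φ⟫_ℂ).re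
      map_add' := fun g g' => by
        rw [← Complex.add_re, ← inner_add_right, ← add_apply, ← map_add]
        congr 5
        ext y
        simp
      map_smul' := fun a g => by
        have : (⟨fun y => ((a • g) y : ℂ), by fun_prop⟩ : C(spectrum ℂ R, ℂ)) =
            (a : ℂ) • ⟨fun y => (g y : ℂ), by fun_prop⟩ := by
          ext y
          simp
        rw [this, map_smul, smul_apply, inner_smul_right]
        simp }
    fun g hg => by
      -- Positivity: g = √g · √g, so the form at g is the square of a norm.
      have : (⟨fun y => (g y : ℂ), by fun_prop⟩ : C(spectrum ℂ R, ℂ)) =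
          star (⟨fun y => (√(g y) : ℂ), by fun_prop⟩ : C(spectrum ℂ R, ℂ)) *
            ⟨fun y => (√(g y) : ℂ), by fun_prop⟩ := by
        ext y
        have : 0 ≤ g y := hg y
        simp only [ContinuousMap.coe_mk, ContinuousMap.mul_apply, ContinuousMap.star_apply,
          Complex.star_def, Complex.conj_ofReal, ← Complex.ofReal_mul, Real.mul_self_sqrt this]
      simp only [LinearMap.coe_mk, AddHom.coe_mk]
      rw [this, map_mul, map_star, mul_apply_eq_comp, ContinuousLinearMap.star_eq_adjoint,
        ContinuousLinearMap.adjoint_inner_right]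
      exact inner_self_nonneg (𝕜 := ℂ)

theorem cfcFunctional_apply (hR : IsStarNormal R) (φ : H)
    (g : CompactlySupportedContinuousMap (spectrum ℂ R) ℝ) :
    cfcFunctional hR φ g = (⟪φ, cfcHom hR ⟨fun y => (g y : ℂ), by fun_prop⟩ φ⟫_ℂ).re := rfl

/-- Riesz–Markov on the compact spectrum represents the real calculus; real and imaginary parts give
the complex one, and f = 1 gives the total mass. -/
theorem exists_measure_hasForm_cfcHom (hR : IsStarNormal R) :
    ∃ μ : H → Measure (spectrum ℂ R), (∀ φ, μ φ Set.univ = ENNReal.ofReal (‖φ‖ ^ 2)) ∧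
      ∀ f : C(spectrum ℂ R, ℂ), HasForm μ f (cfcHom hR f) := by
  let μ : H → Measure (spectrum ℂ R) := fun φ => RealRMK.rieszMeasure (cfcFunctional hR φ)
  have hfin (φ : H) : IsFiniteMeasure (μ φ) :=
    ⟨(isCompact_univ (X := spectrum ℂ R)).measure_lt_top⟩
  have real (φ : H) (g : C(spectrum ℂ R, ℝ)) :
      ⟪φ, cfcHom hR ⟨fun y => (g y : ℂ), by fun_prop⟩ φ⟫_ℂ = ((∫ y, g y ∂(μ φ) : ℝ) : ℂ) := by
    have h := RealRMK.integral_rieszMeasure (cfcFunctional hR φ)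
      (CompactlySupportedContinuousMap.continuousMapEquiv g)
    rw [cfcFunctional_apply] at h
    simp only [CompactlySupportedContinuousMap.continuousMapEquiv_apply_toFun] at h
    rw [h]
    symm
    -- A real function gives a self-adjoint operator, so its quadratic form is real.
    rw [← Complex.conj_eq_iff_re, inner_conj_symm, ← ContinuousLinearMap.adjoint_inner_right,
      ← ContinuousLinearMap.star_eq_adjoint, ← map_star]
    congr 4
    ext y
    simp
  have form (f : C(spectrum ℂ R, ℂ)) : HasForm μ f (cfcHom hR f) := fun φ => by
    have e : f = (⟨fun y => ((f y).re : ℂ), by fun_prop⟩ : C(spectrum ℂ R, ℂ)) +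
        Complex.I • ⟨fun y => ((f y).im : ℂ), by fun_prop⟩ := by
      ext y
      simp [mul_comm Complex.I]
    have h1 := real φ ⟨fun y => (f y).re, by fun_prop⟩
    have h2 := real φ ⟨fun y => (f y).im, by fun_prop⟩
    simp only [ContinuousMap.coe_mk] at h1 h2
    conv_lhs => rw [e, map_add, map_smul, add_apply, smul_apply, inner_add_right,
      inner_smul_right, h1, h2]
    have hi : Integrable (fun y => f y) (μ φ) :=
      f.continuous.integrable_of_hasCompactSupport (HasCompactSupport.of_compactSpace _)
    rw [mul_comm]
    exact integral_re_add_im hi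
  refine ⟨μ, fun φ => ?_, form⟩
  have h := form 1 φ
  rw [map_one, one_apply_eq_self, inner_self_eq_norm_sq_to_K] at h
  simp only [ContinuousMap.one_apply, integral_const, mul_one, Complex.real_smul,
    Complex.coe_algebraMap, ← Complex.ofReal_pow, Complex.ofReal_inj] at h
  rw [h, measureReal_def, ENNReal.ofReal_toReal (measure_ne_top _ _)]

theorem HasForm.sub {X : Type*} [MeasurableSpace X] {μ : H → Measure X} {f g : X → ℂ}
    {S T : H →L[ℂ] H} (hμ : ∀ φ, μ φ Set.univ = ENNReal.ofReal (‖φ‖ ^ 2))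
    (hf : IsBddMeasurable f) (hg : IsBddMeasurable g) (hS : HasForm μ f S) (hT : HasForm μ g T) :
    HasForm μ (fun x => f x - g x) (S - T) := fun φ => by
  have := isFiniteMeasure_of_univ hμ φ
  rw [integral_sub (hf.integrable _) (hg.integrable _), ← hS, ← hT, sub_apply, inner_sub_right]

theorem HasForm.sum {X ι : Type*} [MeasurableSpace X] {μ : H → Measure X} {F : ι → X → ℂ}
    {T : ι → H →L[ℂ] H} (hμ : ∀ φ, μ φ Set.univ = ENNReal.ofReal (‖φ‖ ^ 2))
    (hF : ∀ i, IsBddMeasurable (F i)) (hT : ∀ i, HasForm μ (F i) (T i)) (s : Finset ι) :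
    HasForm μ (fun x => ∑ i ∈ s, F i x) (∑ i ∈ s, T i) := fun φ => by
  have := isFiniteMeasure_of_univ hμ φ
  rw [integral_finsetSum _ fun i _ => (hF i).integrable _, sum_apply,
    inner_sum]
  exact Finset.sum_congr rfl fun i _ => hT i φ

theorem hasSum_indicator_iUnion {X : Type*} {S : ℕ → Set X}
    (hd : Pairwise (Function.onFun Disjoint S)) (x : X) :
    HasSum (fun n => (S n).indicator (fun _ => (1 : ℂ)) x)
      ((⋃ n, S n).indicator (fun _ => 1) x) := by
  by_cases h : ∃ n, x ∈ S n
  · obtain ⟨n, hn⟩ := h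
    have := hasSum_single (f := fun n => (S n).indicator (fun _ => (1 : ℂ)) x) n fun m hm =>
      Set.indicator_of_notMem (fun h' => Set.disjoint_left.1 (hd hm) h' hn) _
    rw [Set.indicator_of_mem (Set.mem_iUnion.2 ⟨n, hn⟩)]
    simpa only [Set.indicator_of_mem hn] using this
  · rw [Set.indicator_of_notMem (by simpa using h)]
    push Not at h
    simp [h]

theorem norm_sum_indicator_le_one {X : Type*} {S : ℕ → Set X}
    (hd : Pairwise (Function.onFun Disjoint S)) (s : Finset ℕ) (x : X) :
    ‖∑ i ∈ s, (S i).indicator (fun _ => (1 : ℂ)) x‖ ≤ 1 := by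
  have := Finset.indicator_biUnion_apply s S (f := fun _ => (1 : ℂ)) (fun i _ j _ h => hd h) x
  rw [← this]
  exact (norm_indicator_le_norm_self _ _).trans (by simp)

/-- A multiplicative family of operators whose forms are given by measures extends from continuous
functions to indicators. -/
theorem exists_hasForm_indicator {Y : Type*} [TopologicalSpace Y] [MeasurableSpace Y] [BorelSpace Y]
    [CompactSpace Y] [HasOuterApproxClosed Y] {μ : H → Measure Y}
    (hμ : ∀ φ, μ φ Set.univ = ENNReal.ofReal (‖φ‖ ^ 2)) {Φ : C(Y, ℂ) → H →L[ℂ] H}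
    (hΦ : ∀ f : C(Y, ℂ), HasForm μ f (Φ f)) {S : Set Y} (hS : MeasurableSet S) :
    ∃ T : H →L[ℂ] H, HasForm μ (S.indicator fun _ => 1) T ∧
      ∀ (g : Y → ℂ) (Q : H →L[ℂ] H), IsBddMeasurable g →
        (∀ f : C(Y, ℂ), HasForm μ (fun y => f y * g y) (Φ f * Q)) →
        HasForm μ (fun y => S.indicator (fun _ => 1) y * g y) (T * Q) := by
  have hone : Φ 1 = 1 := (hΦ 1).unique (HasForm.one hμ)
  have hind {S : Set Y} (hS : MeasurableSet S) :
      IsBddMeasurable (S.indicator fun _ => (1 : ℂ)) := (IsBddMeasurable.const 1).indicator hS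
  -- The clause on g and Q travels through the π-λ induction so that Q can later be first an
  -- operator Φ(f), then another projection. Closed sets are limits of continuous functions;
  -- complements use Φ(1) = 1.
  induction S, hS using MeasurableSpace.induction_on_inter
    ((BorelSpace.measurable_eq (α := Y)).trans borel_eq_generateFrom_isClosed)
    isPiSystem_isClosed with
  | empty => exact ⟨0, fun φ => by simp, fun g Q _ _ φ => by simp⟩
  | basic S hS =>
    have hS : IsClosed S := hS
    let F : ℕ → C(Y, ℂ) := fun n => ⟨fun y => ((hS.apprSeq n y : ℝ) : ℂ), by fun_prop⟩
    have hF1 n y : ‖F n y‖ ≤ 1 := by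
      simpa [F] using HasOuterApproxClosed.apprSeq_apply_le_one hS n y
    have hlim y : Tendsto (fun n => F n y) atTop (𝓝 (S.indicator (fun _ => 1) y)) := by
      have h := tendsto_pi_nhds.1 (HasOuterApproxClosed.tendsto_apprSeq hS) y
      have h2 := ((Complex.continuous_ofReal.comp NNReal.continuous_coe).tendsto _).comp h
      have e : S.indicator (fun _ => (1 : ℂ)) y =
          (Complex.ofReal ∘ NNReal.toReal) (S.indicator (fun _ => 1) y) := by
        by_cases hy : y ∈ S <;> simp [hy]
      rw [e]
      exact h2
    have hFm n : Measurable (F n) := (F n).continuous.measurable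
    obtain ⟨T, hT⟩ := exists_hasForm_of_tendsto hμ hFm hF1 hlim fun n => ⟨_, hΦ (F n)⟩
    exact ⟨T, hT, fun g Q hg hQ => HasForm.mul_of_tendsto hμ hg hFm hF1 hlim
      (fun n => hΦ (F n)) hT fun n => hQ (F n)⟩
  | compl S hS ih =>
    obtain ⟨T, hT, hTm⟩ := ih
    have e y : Sᶜ.indicator (fun _ => (1 : ℂ)) y = 1 - S.indicator (fun _ => 1) y := by
      by_cases hy : y ∈ S <;> simp [hy]
    refine ⟨1 - T, ?_, fun g Q hg hQ => ?_⟩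
    · convert (HasForm.one hμ).sub hμ (IsBddMeasurable.const 1) (hind hS) hT using 1
      exact funext e
    · have h1 := hQ 1
      rw [hone, one_mul] at h1
      simp only [ContinuousMap.one_apply, one_mul] at h1
      rw [sub_mul, one_mul]
      convert h1.sub hμ hg ((hind hS).mul hg) (hTm g Q hg hQ) using 1
      ext y
      rw [e]
      ring
  | iUnion S hd hS ih =>
    choose T hT hTm using ih
    have hb n : ∀ y, ‖∑ i ∈ Finset.range n, (S i).indicator (fun _ => (1 : ℂ)) y‖ ≤ 1 :=
      norm_sum_indicator_le_one hd _
    have hm n : Measurable fun y => ∑ i ∈ Finset.range n, (S i).indicator (fun _ => (1 : ℂ)) y :=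
      Finset.measurable_sum _ fun i _ => (hind (hS i)).measurable
    have hlim y := (hasSum_indicator_iUnion hd y).tendsto_sum_nat
    have hf n := HasForm.sum hμ (fun i => hind (hS i)) hT (Finset.range n)
    obtain ⟨T₀, hT₀⟩ := exists_hasForm_of_tendsto hμ hm hb hlim fun n => ⟨_, hf n⟩
    refine ⟨T₀, hT₀, fun g Q hg hQ => HasForm.mul_of_tendsto hμ hg hm hb hlim hf hT₀ fun n => ?_⟩
    rw [Finset.sum_mul]
    convert HasForm.sum hμ (fun i => (hind (hS i)).mul hg) (fun i => hTm i g Q hg hQ)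
      (Finset.range n) using 2 with y
    rw [Finset.sum_mul]

end Normal

/-! ### Transport of a spectral resolution from the spectrum to the real line. -/

section PushForward

variable {Y : Type*} [MeasurableSpace Y] {μ : H → Measure Y} {T : Set Y → H →L[ℂ] H}

theorem HasForm.norm_sq_indicator {S : Set Y}
    (hS : MeasurableSet S) {P : H →L[ℂ] H} (hP : HasForm μ (S.indicator fun _ => 1) P)
    (hsq : P * P = P) (φ : H) : ‖P φ‖ ^ 2 = (μ φ).real S := by
  have hstar : star P = P := by
    refine HasForm.unique hP.conj ?_
    convert hP using 2 with y
    by_cases hy : y ∈ S <;> simp [hy]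
  have h := hP φ
  rw [integral_indicator_const _ hS, ← hsq, mul_apply_eq_comp] at h
  conv_lhs at h => rw [← ContinuousLinearMap.adjoint_inner_left,
    ← ContinuousLinearMap.star_eq_adjoint, hstar, inner_self_eq_norm_sq_to_K]
  refine Complex.ofReal_injective (Eq.trans ?_ (h.trans ?_)) <;> simp

/-- A multiplicative family of indicator operators on `Y` is pushed forward to a projection-valued
measure on the line. -/
theorem exists_projectionValuedMeasure_map
    (hμ : ∀ φ, μ φ Set.univ = ENNReal.ofReal (‖φ‖ ^ 2))
    (hT : ∀ S, MeasurableSet S → HasForm μ (S.indicator fun _ => 1) (T S))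
    (hmul : ∀ S S', MeasurableSet S → MeasurableSet S' → T (S ∩ S') = T S * T S')
    {h : Y → ℝ} (hh : Measurable h) :
    ∃ E : ProjectionValuedMeasure H, ∀ φ, E.scalarMeasure φ = (μ φ).map h := by
  have hind {S : Set Y} (hS : MeasurableSet S) :
      IsBddMeasurable (S.indicator fun _ => (1 : ℂ)) := (IsBddMeasurable.const 1).indicator hS
  have hsq S (hS : MeasurableSet S) : T S * T S = T S := by
    rw [← hmul S S hS hS, Set.inter_self]
  have hstar S (hS : MeasurableSet S) : star (T S) = T S := by
    refine HasForm.unique (hT S hS).conj ?_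
    convert hT S hS using 2 with y
    by_cases hy : y ∈ S <;> simp [hy]
  have hnorm S (hS : MeasurableSet S) (φ : H) : ‖T S φ‖ ^ 2 = (μ φ).real S :=
    (hT S hS).norm_sq_indicator hS (hsq S hS) φ
  let E : ProjectionValuedMeasure H :=
    { proj := fun S => T (h ⁻¹' S)
      isStarProjection := fun S hS => ⟨hsq _ (hh hS), hstar _ (hh hS)⟩
      proj_univ := by
        refine HasForm.unique (hT _ (hh MeasurableSet.univ)) ?_
        simpa using HasForm.one hμ
      proj_inter := fun S S' hS hS' => hmul _ _ (hh hS) (hh hS')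
      hasSum_proj := fun S hS hd φ => by
        have := isFiniteMeasure_of_univ hμ φ
        set U := fun n => h ⁻¹' (S n) with hU
        have hUm n : MeasurableSet (U n) := hh (hS n)
        have hUd : Pairwise (Function.onFun Disjoint U) := fun i j hij =>
          (hd hij).preimage h
        rw [Set.preimage_iUnion]
        have hUU : MeasurableSet (⋃ n, U n) := MeasurableSet.iUnion hUm
        -- The error of a partial sum is itself the projection of the remaining set, so its norm
        -- square is the measure of that set; strong σ-additivity thus reduces to σ-additivity of
        -- the scalar measure.
        have key (s : Finset ℕ) :
            ‖T (⋃ n, U n) φ - ∑ n ∈ s, T (U n) φ‖ ^ 2 =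
              (μ φ).real (⋃ n, U n) - ∑ n ∈ s, (μ φ).real (U n) := by
          have hUs : MeasurableSet (⋃ n ∈ s, U n) := s.measurableSet_biUnion fun n _ => hUm n
          have hle : (⋃ n ∈ s, U n) ⊆ ⋃ n, U n :=
            Set.iUnion₂_subset fun n _ => Set.subset_iUnion U n
          have h1 : T ((⋃ n, U n) \ ⋃ n ∈ s, U n) = T (⋃ n, U n) - ∑ n ∈ s, T (U n) := by
            refine HasForm.unique (hT _ (hUU.diff hUs)) ?_
            convert (hT _ hUU).sub hμ (hind hUU) ?_
              (HasForm.sum hμ (fun n => hind (hUm n)) (fun n => hT _ (hUm n)) s) using 1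
            · ext y
              rw [← Finset.indicator_biUnion_apply s U (fun i _ j _ hij => hUd hij) y,
                Set.indicator_sdiff hle]
              rfl
            · exact ⟨Finset.measurable_sum _ fun n _ => (hind (hUm n)).measurable, 1,
                norm_sum_indicator_le_one hUd s⟩
          have h2 := hnorm _ (hUU.diff hUs) φ
          rw [h1, sub_apply, sum_apply, measureReal_sdiff hle hUs,
            measureReal_biUnion_finset (fun i _ j _ hij => hUd hij) fun n _ => hUm n] at h2
          exact h2
        have hsum : HasSum (fun n => (μ φ).real (U n)) ((μ φ).real (⋃ n, U n)) := by
          have h2 := ENNReal.hasSum_toReal (f := fun n => μ φ (U n))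
            (by rw [← measure_iUnion hUd hUm]; exact measure_ne_top _ _)
          rw [← ENNReal.tsum_toReal_eq fun n => measure_ne_top _ _, ← measure_iUnion hUd hUm] at h2
          exact h2
        have h0 : Tendsto (fun s : Finset ℕ => ‖T (⋃ n, U n) φ - ∑ n ∈ s, T (U n) φ‖ ^ 2) atTop
            (𝓝 0) := by
          simp_rw [key]
          simpa using (tendsto_const_nhds (x := (μ φ).real (⋃ n, U n))).sub hsum
        have h1 := h0.sqrt
        simp only [Real.sqrt_sq (norm_nonneg _), Real.sqrt_zero] at h1
        rw [HasSum, tendsto_iff_norm_sub_tendsto_zero]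
        simpa [norm_sub_rev] using h1 }
  refine ⟨E, fun φ => ?_⟩
  have := isFiniteMeasure_of_univ hμ φ
  ext S hS
  rw [← E.enorm_sq_proj φ hS, Measure.map_apply hh hS, ← ofReal_norm,
    ← ENNReal.ofReal_pow (norm_nonneg _)]
  change ENNReal.ofReal (‖T (h ⁻¹' S) φ‖ ^ 2) = _
  rw [hnorm _ (hh hS), ofReal_measureReal]

end PushForward

/-! ### Resolvents of self-adjoint operators -/

section SelfAdjoint

variable {B : H →ₗ.[ℂ] H}

theorem inner_apply_left_of_isSelfAdjoint (hB : IsSelfAdjoint B) (φ ψ : B.domain) :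
    ⟪B φ, (ψ : H)⟫_ℂ = ⟪(φ : H), B ψ⟫_ℂ := by
  have h := LinearPMap.adjoint_isFormalAdjoint hB.dense_domain
  rw [LinearPMap.isSelfAdjoint_def.1 hB] at h
  exact h φ ψ

theorem exists_apply_eq_of_isSelfAdjoint (hB : IsSelfAdjoint B) {y w : H}
    (h : ∀ x : B.domain, ⟪w, (x : H)⟫_ℂ = ⟪y, B x⟫_ℂ) : ∃ hy : y ∈ B.domain, B ⟨y, hy⟩ = w := by
  have hd := hB.dense_domain
  have hmem := B.mem_adjoint_domain_of_exists y ⟨w, h⟩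
  -- Abstracting the adjoint to a variable C allows substitution although the membership proof
  -- depends on the operator.
  have key : ∀ C : H →ₗ.[ℂ] H, B.adjoint = C → ∃ hy : y ∈ C.domain, C ⟨y, hy⟩ = w := by
    rintro C rfl
    exact ⟨hmem, LinearPMap.adjoint_apply_eq hd ⟨y, hmem⟩ h⟩
  exact key B (LinearPMap.isSelfAdjoint_def.1 hB)

theorem mem_domain_of_isSelfAdjoint (hB : IsSelfAdjoint B) {y : H} {c : ℝ}
    (h : ∀ x : B.domain, ‖⟪y, B x⟫_ℂ‖ ≤ c * ‖(x : H)‖) : y ∈ B.domain := by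
  have : y ∈ B.adjoint.domain := (B.mem_adjoint_domain_iff y).2
    (AddMonoidHomClass.continuous_of_bound _ c h)
  rwa [LinearPMap.isSelfAdjoint_def.1 hB] at this

namespace IsResolventAt

variable {z : ℂ} {R : H →L[ℂ] H}

theorem mem_domain (hR : IsResolventAt B z R) (ψ : H) : R ψ ∈ B.domain := (hR.1 ψ).1

theorem apply (hR : IsResolventAt B z R) (ψ : H) :
    B ⟨R ψ, hR.mem_domain ψ⟩ = ψ + z • R ψ := by
  obtain ⟨h, e⟩ := hR.1 ψ
  exact sub_eq_iff_eq_add.1 e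

theorem injective (hR : IsResolventAt B z R) : Function.Injective R := by
  rw [injective_iff_map_eq_zero]
  intro ψ hψ
  have h := hR.apply ψ
  have : (⟨R ψ, hR.mem_domain ψ⟩ : B.domain) = 0 := Subtype.ext hψ
  rw [this, LinearPMap.map_zero, hψ, smul_zero, add_zero] at h
  exact h.symm

/-- Taking adjoints in R(B − z) = 1 on the domain, self-adjointness turns R⋆ into a right inverse of
B − z̄. -/
theorem adjoint_apply (hB : IsSelfAdjoint B) (hR : IsResolventAt B z R) (y : H) :
    ∃ h : star R y ∈ B.domain, B ⟨star R y, h⟩ = y + starRingEnd ℂ z • star R y := by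
  refine exists_apply_eq_of_isSelfAdjoint hB fun x => ?_
  have h := congrArg (fun v => ⟪y, v⟫_ℂ) (hR.2 x)
  simp only [map_sub, map_smul, inner_sub_right, inner_smul_right] at h
  rw [inner_add_left, inner_smul_left, Complex.conj_conj, ContinuousLinearMap.star_eq_adjoint,
    ContinuousLinearMap.adjoint_inner_left, ContinuousLinearMap.adjoint_inner_left, ← h]
  ring

theorem sub_star (hB : IsSelfAdjoint B) (hR : IsResolventAt B z R) :
    R - star R = (z - starRingEnd ℂ z) • (R * star R) := by
  ext y
  obtain ⟨h, e⟩ := hR.adjoint_apply hB y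
  have h2 := hR.2 ⟨star R y, h⟩
  rw [e] at h2
  simp only [map_sub, map_add, map_smul] at h2
  simp only [sub_apply, smul_apply, mul_apply_eq_comp]
  conv_lhs => rw [← h2]
  module

theorem star_mul_self (hB : IsSelfAdjoint B) (hR : IsResolventAt B z R) (φ : B.domain) :
    star R (B φ - starRingEnd ℂ z • (φ : H)) = φ := by
  refine ext_inner_right ℂ fun ψ => ?_
  rw [ContinuousLinearMap.star_eq_adjoint, ContinuousLinearMap.adjoint_inner_left, inner_sub_left,
    inner_smul_left, Complex.conj_conj]
  have h := inner_apply_left_of_isSelfAdjoint hB φ ⟨R ψ, hR.mem_domain ψ⟩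
  rw [hR.apply ψ] at h
  simp only at h
  rw [h, inner_add_right, inner_smul_right]
  ring

/-- The resolvent identity between z and z̄ holds with both orders of R and R⋆. If z is not real,
the factor z − z̄ cancels and the products agree; if z is real, R = R⋆. -/
theorem isStarNormal (hB : IsSelfAdjoint B) (hR : IsResolventAt B z R) : IsStarNormal R := by
  have h2 : R - star R = (z - starRingEnd ℂ z) • (star R * R) := by
    ext y
    have h := hR.star_mul_self hB ⟨R y, hR.mem_domain y⟩
    rw [hR.apply y] at h
    simp only [map_sub, map_add, map_smul] at h
    simp only [sub_apply, smul_apply, mul_apply_eq_comp]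
    conv_lhs => rw [← h]
    module
  refine ⟨?_⟩
  rw [commute_iff_eq]
  by_cases hz : z - starRingEnd ℂ z = 0
  · rw [hz, zero_smul, sub_eq_zero] at h2
    rw [← h2]
  · exact smul_right_injective _ hz (h2.symm.trans (hR.sub_star hB))

end IsResolventAt

/-- The function `1 / (λ - z)`, cut off near `z`. -/
def cutoffResolvent (z : ℂ) (c : ℝ) (x : ℝ) : ℂ :=
  if 1 ≤ c * ‖(x : ℂ) - z‖ then ((x : ℂ) - z)⁻¹ else 0

theorem measurableSet_cutoff (z : ℂ) (c : ℝ) :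
    MeasurableSet {x : ℝ | 1 ≤ c * ‖(x : ℂ) - z‖} :=
  measurableSet_le (by fun_prop) (by fun_prop)

theorem isBddMeasurable_cutoffResolvent (z : ℂ) {c : ℝ} (hc : 0 ≤ c) :
    IsBddMeasurable (cutoffResolvent z c) := by
  refine ⟨Measurable.ite (measurableSet_cutoff z c) (by fun_prop) measurable_const, c, fun x => ?_⟩
  unfold cutoffResolvent
  split_ifs with h
  · rw [norm_inv]
    have : 0 < ‖(x : ℂ) - z‖ := by
      by_contra h'
      have : ‖(x : ℂ) - z‖ = 0 := le_antisymm (not_lt.1 h') (norm_nonneg _)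
      rw [this] at h
      norm_num at h
    rw [inv_le_iff_one_le_mul₀ this]
    exact h
  · simpa

/-- The resolvent of a self-adjoint operator is a spectral integral. -/
theorem exists_integral_eq_resolvent (hB : IsSelfAdjoint B) {z : ℂ} {R : H →L[ℂ] H}
    (hR : IsResolventAt B z R) :
    ∃ (E : ProjectionValuedMeasure H) (c : ℝ), 0 ≤ c ∧
      (∀ φ, ∀ᵐ x : ℝ ∂(E.scalarMeasure φ), 1 ≤ c * ‖(x : ℂ) - z‖) ∧
      E.integral (cutoffResolvent z c) = R := by
  have hN := hR.isStarNormal hB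
  obtain ⟨μ, hμ, hΦ⟩ := exists_measure_hasForm_cfcHom hN
  have hind {S : Set (spectrum ℂ R)} (hS : MeasurableSet S) :
      IsBddMeasurable (S.indicator fun _ => (1 : ℂ)) := (IsBddMeasurable.const 1).indicator hS
  have hcont (f : C(spectrum ℂ R, ℂ)) : IsBddMeasurable f :=
    ⟨f.continuous.measurable, ‖f‖, f.norm_coe_le_norm⟩
  have hex (S : Set (spectrum ℂ R)) : ∃ T : H →L[ℂ] H, MeasurableSet S →
      HasForm μ (S.indicator fun _ => 1) T ∧
      ∀ (g : spectrum ℂ R → ℂ) (Q : H →L[ℂ] H), IsBddMeasurable g →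
        (∀ f : C(spectrum ℂ R, ℂ), HasForm μ (fun y => f y * g y) (cfcHom hN f * Q)) →
        HasForm μ (fun y => S.indicator (fun _ => 1) y * g y) (T * Q) := by
    by_cases hS : MeasurableSet S
    · obtain ⟨T, hT⟩ := exists_hasForm_indicator hμ hΦ hS
      exact ⟨T, fun _ => hT⟩
    · exact ⟨0, fun h => absurd h hS⟩
  choose T hT using hex
  have hT1 S (hS : MeasurableSet S) := (hT S hS).1
  have hstar S (hS : MeasurableSet S) : star (T S) = T S := by
    refine HasForm.unique (hT1 S hS).conj ?_
    convert hT1 S hS using 2 with y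
    by_cases hy : y ∈ S <;> simp [hy]
  -- The product clause with Q the operator of f̄ puts the indicator operator on the left; the
  -- adjoint puts it on the right.
  have hmulc (f : C(spectrum ℂ R, ℂ)) S (hS : MeasurableSet S) :
      HasForm μ (fun y => f y * S.indicator (fun _ => 1) y) (cfcHom hN f * T S) := by
    have h := ((hT S hS).2 _ (cfcHom hN (star f)) (hcont (star f)) fun f' => by
      rw [← map_mul]
      exact hΦ (f' * star f)).conj
    rw [star_mul, hstar S hS, map_star, star_star] at h
    convert h using 2 with y
    by_cases hy : y ∈ S <;> simp [hy]
  have hmul S S' (hS : MeasurableSet S) (hS' : MeasurableSet S') : T (S ∩ S') = T S * T S' := by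
    refine HasForm.unique (hT1 _ (hS.inter hS')) ?_
    convert (hT S hS).2 _ (T S') (hind hS') (fun f => hmulc f S' hS') using 1
    ext y
    by_cases hy : y ∈ S <;> by_cases hy' : y ∈ S' <;> simp [hy, hy']
  have hid : cfcHom hN ((ContinuousMap.id ℂ).restrict (spectrum ℂ R)) = R := cfcHom_id hN
  -- R times the projection of {0} has form y · 1_{y = 0} = 0, and R is injective. So the point
  -- where 1/y is meaningless carries no mass.
  have hzero (φ : H) : ∀ᵐ y : spectrum ℂ R ∂(μ φ), (y : ℂ) ≠ 0 := by
    have h0 : MeasurableSet {y : spectrum ℂ R | (y : ℂ) = 0} :=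
      measurableSet_eq_fun measurable_subtype_coe measurable_const
    have h1 : R * T {y | (y : ℂ) = 0} = 0 := by
      have h2 := hmulc ((ContinuousMap.id ℂ).restrict (spectrum ℂ R)) _ h0
      rw [hid] at h2
      refine HasForm.unique h2 fun φ => ?_
      have : ∀ y : spectrum ℂ R, ((ContinuousMap.id ℂ).restrict (spectrum ℂ R)) y *
          {y : spectrum ℂ R | (y : ℂ) = 0}.indicator (fun _ => (1 : ℂ)) y = 0 := fun y => by
        by_cases hy : (y : ℂ) = 0 <;> simp [hy]
      simp_rw [this]
      simp
    have h3 : T {y | (y : ℂ) = 0} φ = 0 := hR.injective (by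
      rw [map_zero]
      exact congrArg (fun S : H →L[ℂ] H => S φ) h1)
    have := isFiniteMeasure_of_univ hμ φ
    have h4 := (hT1 _ h0).norm_sq_indicator h0 (by rw [← hmul _ _ h0 h0, Set.inter_self]) φ
    rw [h3, norm_zero, zero_pow two_ne_zero] at h4
    rw [ae_iff]
    simpa using ((measureReal_eq_zero_iff).1 h4.symm)
  -- Injectivity of the calculus carries the resolvent identity to points of the spectrum. Divided
  -- by yȳ, it says that 1/y + z is real.
  have hspec (y : spectrum ℂ R) :
      (y : ℂ) - starRingEnd ℂ y = (z - starRingEnd ℂ z) * (y * starRingEnd ℂ y) := by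
    have h1 : cfcHom hN ((ContinuousMap.id ℂ).restrict (spectrum ℂ R) -
        star ((ContinuousMap.id ℂ).restrict (spectrum ℂ R))) =
        cfcHom hN ((z - starRingEnd ℂ z) • ((ContinuousMap.id ℂ).restrict (spectrum ℂ R) *
        star ((ContinuousMap.id ℂ).restrict (spectrum ℂ R)))) := by
      rw [map_sub, map_smul, map_mul, map_star, hid]
      exact hR.sub_star hB
    have h2 := cfcHom_injective hN h1
    simpa using congrArg (fun f : C(spectrum ℂ R, ℂ) => f y) h2
  let h : spectrum ℂ R → ℝ := fun y => ((y : ℂ)⁻¹ + z).re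
  have hh : Measurable h := by fun_prop
  have hval (y : spectrum ℂ R) (hy : (y : ℂ) ≠ 0) : (h y : ℂ) - z = (y : ℂ)⁻¹ := by
    have : ((h y : ℝ) : ℂ) = (y : ℂ)⁻¹ + z := by
      rw [← Complex.conj_eq_iff_re, map_add, map_inv₀]
      have h1 := hspec y
      have h2 : starRingEnd ℂ (y : ℂ) ≠ 0 := by simpa using hy
      field_simp
      linear_combination h1
    rw [this]
    ring
  obtain ⟨E, hE⟩ := exists_projectionValuedMeasure_map hμ hT1 hmul hh
  -- Spectral points satisfy |y| ≤ c and |h(y) − z| = 1/|y|, so the cut-off, needed because z may be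
  -- real, removes only a null set. The factor ‖1‖ covers the zero space.
  set c := ‖R‖ * ‖(1 : H →L[ℂ] H)‖ with hc
  have hcut (y : spectrum ℂ R) (hy : (y : ℂ) ≠ 0) : 1 ≤ c * ‖(h y : ℂ) - z‖ := by
    rw [hval y hy, norm_inv, ← div_eq_mul_inv, one_le_div (norm_pos_iff.2 hy)]
    exact spectrum.norm_le_norm_mul_of_mem y.2
  have hc0 : 0 ≤ c := by positivity
  refine ⟨E, c, hc0, fun φ => ?_, ?_⟩
  · rw [hE, ae_map_iff hh.aemeasurable (measurableSet_cutoff z c)]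
    filter_upwards [hzero φ] with y hy using hcut y hy
  · have hb := isBddMeasurable_cutoffResolvent z hc0
    refine E.integral_eq hb fun φ => ?_
    rw [hE, integral_map hh.aemeasurable hb.measurable.aestronglyMeasurable]
    have h1 := hΦ ((ContinuousMap.id ℂ).restrict (spectrum ℂ R)) φ
    rw [hid] at h1
    rw [h1]
    refine integral_congr_ae ?_
    filter_upwards [hzero φ] with y hy
    rw [cutoffResolvent, if_pos (hcut y hy), hval y hy, inv_inv]
    rfl

end SelfAdjoint

/-! ### The spectral theorem -/

section SpectralTheorem

variable {B : H →ₗ.[ℂ] H}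

theorem ProjectionValuedMeasure.integral_congr_ae (E : ProjectionValuedMeasure H) {f g : ℝ → ℂ}
    (hf : IsBddMeasurable f) (hg : IsBddMeasurable g)
    (h : ∀ φ, f =ᵐ[E.scalarMeasure φ] g) : E.integral f = E.integral g :=
  E.integral_eq hf fun φ => by
    rw [E.hasForm_integral hg φ, MeasureTheory.integral_congr_ae (h φ)]

theorem mul_cutoffResolvent {z : ℂ} {c x : ℝ} (hx : 1 ≤ c * ‖(x : ℂ) - z‖) :
    (x : ℂ) * cutoffResolvent z c x = 1 + z * cutoffResolvent z c x := by
  have : (x : ℂ) - z ≠ 0 := fun h => by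
    rw [h, norm_zero, mul_zero] at hx
    norm_num at hx
  rw [cutoffResolvent, if_pos hx]
  field_simp
  ring

theorem norm_mul_cutoffResolvent_le (z : ℂ) {c : ℝ} (hc : 0 ≤ c) (x : ℝ) :
    ‖(x : ℂ) * cutoffResolvent z c x‖ ≤ 1 + ‖z‖ * c := by
  by_cases hx : 1 ≤ c * ‖(x : ℂ) - z‖
  · rw [mul_cutoffResolvent hx]
    refine (norm_add_le _ _).trans ?_
    rw [norm_one, norm_mul]
    have : ‖cutoffResolvent z c x‖ ≤ c := by
      have h0 : 0 < ‖(x : ℂ) - z‖ := by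
        by_contra h
        have : ‖(x : ℂ) - z‖ = 0 := le_antisymm (not_lt.1 h) (norm_nonneg _)
        rw [this] at hx
        norm_num at hx
      rw [cutoffResolvent, if_pos hx, norm_inv, inv_le_iff_one_le_mul₀ h0]
      exact hx
    gcongr
  · rw [cutoffResolvent, if_neg hx, mul_zero, norm_zero]
    positivity

theorem isBddMeasurable_indicator_id (n : ℕ) :
    IsBddMeasurable ((Set.Icc (-n : ℝ) n).indicator fun x : ℝ => (x : ℂ)) := by
  refine ⟨Complex.measurable_ofReal.indicator measurableSet_Icc, n, fun x => ?_⟩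
  by_cases hx : x ∈ Set.Icc (-n : ℝ) n
  · rw [Set.indicator_of_mem hx, Complex.norm_real]
    exact abs_le.2 hx
  · rw [Set.indicator_of_notMem hx, norm_zero]
    positivity

theorem tendsto_inner_proj_Icc (E : ProjectionValuedMeasure H) (ψ φ : H) :
    Tendsto (fun n : ℕ => ⟪ψ, E.proj (Set.Icc (-n : ℝ) n) φ⟫_ℂ) atTop (𝓝 ⟪ψ, φ⟫_ℂ) := by
  have hind (n : ℕ) : IsBddMeasurable ((Set.Icc (-n : ℝ) n).indicator fun _ => (1 : ℂ)) :=
    (IsBddMeasurable.const 1).indicator measurableSet_Icc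
  refine HasForm.tendsto_inner (c := 1) (T := 1) E.scalarMeasure_univ
    (fun n => (hind n).measurable) (fun n x => ?_) (fun x => ?_)
    (fun n => ?_) (HasForm.one E.scalarMeasure_univ) ψ φ
  · exact (norm_indicator_le_norm_self _ _).trans (by simp)
  · obtain ⟨N, hN⟩ := exists_nat_ge |x|
    refine tendsto_const_nhds.congr' ?_
    filter_upwards [eventually_ge_atTop N] with n hn
    rw [Set.indicator_of_mem]
    exact abs_le.1 (hN.trans (by exact_mod_cast hn))
  · simpa using E.hasForm_indicator 1 (measurableSet_Icc (a := (-n : ℝ)) (b := n))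

/-- The spectral theorem for self-adjoint operators with nonempty resolvent set. -/
theorem exists_isSpectralMeasure (hB : IsSelfAdjoint B) {z : ℂ} (hz : z ∈ resolventSet B) :
    ∃ E : ProjectionValuedMeasure H, IsSpectralMeasure B E := by
  obtain ⟨R, hR⟩ := hz
  obtain ⟨E, c, hc, hae, hER⟩ := exists_integral_eq_resolvent hB hR
  have hb := isBddMeasurable_cutoffResolvent z hc
  have hrange (φ : B.domain) : R (B φ - z • (φ : H)) = φ := hR.2 φ
  have hmeas (ψ : H) : E.scalarMeasure (R ψ) =
      (E.scalarMeasure ψ).withDensity fun x => ‖cutoffResolvent z c x‖ₑ ^ 2 := by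
    rw [← hER]
    exact E.scalarMeasure_integral_apply hb ψ
  have hm2 : Measurable fun x => ‖cutoffResolvent z c x‖ₑ ^ 2 := hb.measurable.enorm.pow_const 2
  refine ⟨E, fun φ => ⟨fun hφ => ?_, fun hφ => ?_⟩, fun φ => ?_⟩
  -- The domain is the range of R, and R multiplies the scalar measure by |r|², where r is the
  -- cut-off resolvent function; λ r(λ) is bounded.
  · obtain ⟨ψ, rfl⟩ : ∃ ψ, φ = R ψ := ⟨_, (hrange ⟨φ, hφ⟩).symm⟩
    rw [hmeas, lintegral_withDensity_eq_lintegral_mul _ hm2 (by fun_prop)]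
    refine (lintegral_mono (g := fun _ => ENNReal.ofReal ((1 + ‖z‖ * c) ^ 2)) fun x => ?_).trans_lt
      ?_
    · have h := norm_mul_cutoffResolvent_le z hc x
      simp only [Pi.mul_apply]
      rw [← ofReal_norm, ← ENNReal.ofReal_pow (norm_nonneg _),
        ← ENNReal.ofReal_mul (by positivity)]
      refine ENNReal.ofReal_le_ofReal ?_
      rw [norm_mul, Complex.norm_real] at h
      calc ‖cutoffResolvent z c x‖ ^ 2 * x ^ 2 = (‖x‖ * ‖cutoffResolvent z c x‖) ^ 2 := by
            rw [mul_pow, Real.norm_eq_abs, sq_abs, mul_comm]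
        _ ≤ _ := by gcongr
    · rw [lintegral_const]
      exact ENNReal.mul_lt_top ENNReal.ofReal_lt_top (measure_lt_top _ _)
  -- Truncated to [-n, n], B moves to the left as a bounded operator. Its norm on φ is at most the
  -- square root of the second moment, so letting n → ∞ puts φ in the domain of the adjoint, which
  -- is that of B.
  · have key (n : ℕ) (χ : B.domain) : ⟪φ, E.proj (Set.Icc (-n : ℝ) n) (B χ)⟫_ℂ =
        ⟪E.integral ((Set.Icc (-n : ℝ) n).indicator fun x : ℝ => (x : ℂ)) φ, (χ : H)⟫_ℂ := by
      have hn := isBddMeasurable_indicator_id n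
      have hi : IsBddMeasurable ((Set.Icc (-n : ℝ) n).indicator fun _ => (1 : ℂ)) :=
        (IsBddMeasurable.const 1).indicator measurableSet_Icc
      have hstar : star (E.integral ((Set.Icc (-n : ℝ) n).indicator fun x : ℝ => (x : ℂ))) =
          E.integral ((Set.Icc (-n : ℝ) n).indicator fun x : ℝ => (x : ℂ)) := by
        rw [← E.integral_conj hn]
        congr 1
        ext x
        by_cases hx : x ∈ Set.Icc (-n : ℝ) n <;> simp only [Set.indicator_of_mem, hx,
          Set.indicator_of_notMem, not_false_eq_true, Complex.conj_ofReal, map_zero]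
      rw [← hstar, ContinuousLinearMap.star_eq_adjoint, ContinuousLinearMap.adjoint_inner_left]
      congr 1
      set η := B χ - z • (χ : H) with hη
      have hχ : (χ : H) = R η := (hrange χ).symm
      have hBχ : B χ = (1 + z • R) η := by
        rw [add_apply, smul_apply, ← hχ, hη]
        simp
      have h1 : (1 : H →L[ℂ] H) + z • R =
          E.integral (fun x => 1 + z * cutoffResolvent z c x) := by
        rw [E.integral_add (IsBddMeasurable.const 1) ((IsBddMeasurable.const z).mul hb),
          E.integral_const_mul z hb, E.integral_one, hER]
      rw [hBχ, hχ, ← hER, ← mul_apply_eq_comp, hER, h1,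
        ← E.integral_indicator_one measurableSet_Icc,
        ← mul_apply_eq_comp, ← E.integral_mul hi
          ((IsBddMeasurable.const 1).add ((IsBddMeasurable.const z).mul hb)), ← hER,
        ← E.integral_mul hn hb]
      congr 1
      refine E.integral_congr_ae (hi.mul ((IsBddMeasurable.const 1).add
        ((IsBddMeasurable.const z).mul hb))) (hn.mul hb) fun ψ => ?_
      filter_upwards [hae ψ] with x hx
      by_cases hxn : x ∈ Set.Icc (-n : ℝ) n
      · rw [Set.indicator_of_mem hxn, Set.indicator_of_mem hxn, mul_cutoffResolvent hx, one_mul]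
      · rw [Set.indicator_of_notMem hxn, Set.indicator_of_notMem hxn, zero_mul, zero_mul]
    set I := ∫⁻ x, ENNReal.ofReal (x ^ 2) ∂(E.scalarMeasure φ) with hI
    refine mem_domain_of_isSelfAdjoint hB (c := √I.toReal) fun χ => ?_
    refine le_of_tendsto (tendsto_inner_proj_Icc E φ (B χ)).norm (Eventually.of_forall fun n => ?_)
    rw [key]
    refine (norm_inner_le_norm _ _).trans ?_
    gcongr
    refine Real.le_sqrt_of_sq_le ?_
    have h2 := E.lintegral_enorm_sq (isBddMeasurable_indicator_id n) φ
    have h3 : ‖E.integral ((Set.Icc (-n : ℝ) n).indicator fun x : ℝ => (x : ℂ)) φ‖ₑ ^ 2 ≤ I := by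
      rw [h2]
      refine lintegral_mono fun x => ?_
      by_cases hxn : x ∈ Set.Icc (-n : ℝ) n
      · rw [Set.indicator_of_mem hxn, ← ofReal_norm, ← ENNReal.ofReal_pow (norm_nonneg _),
          Complex.norm_real, Real.norm_eq_abs, sq_abs]
      · simp [Set.indicator_of_notMem hxn]
    have h4 := ENNReal.toReal_mono hφ.ne h3
    rwa [ENNReal.toReal_pow, toReal_enorm] at h4
  -- With φ = Rη and Bφ = (1 + zR)η, the form at φ is the integral of r̄(1 + zr) = λ|r|² against the
  -- measure of η, that is, of λ against the measure of φ.
  · set η := B φ - z • (φ : H) with hη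
    have hφ : (φ : H) = R η := (hrange φ).symm
    have hBφ : B φ = (1 + z • R) η := by
      rw [add_apply, smul_apply, ← hφ, hη]
      simp
    have h1 : (1 : H →L[ℂ] H) + z • R =
        E.integral (fun x => 1 + z * cutoffResolvent z c x) := by
      rw [E.integral_add (IsBddMeasurable.const 1) ((IsBddMeasurable.const z).mul hb),
        E.integral_const_mul z hb, E.integral_one, hER]
    have hb1 := (IsBddMeasurable.const (X := ℝ) 1).add ((IsBddMeasurable.const z).mul hb)
    have h2 := E.hasForm_integral (hb.conj.mul hb1) η
    rw [E.integral_mul hb.conj hb1, ← h1, E.integral_conj hb, hER, mul_apply_eq_comp,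
      ContinuousLinearMap.star_eq_adjoint, ContinuousLinearMap.adjoint_inner_right, ← hBφ, ← hφ]
      at h2
    rw [h2, hφ, hmeas]
    have h3 : (fun x => ‖cutoffResolvent z c x‖ₑ ^ 2) =
        fun x => ((‖cutoffResolvent z c x‖₊ ^ 2 : NNReal) : ℝ≥0∞) := by
      ext x
      push_cast
      rfl
    rw [h3, integral_withDensity_eq_integral_smul (hb.measurable.nnnorm.pow_const 2)]
    refine MeasureTheory.integral_congr_ae ?_
    filter_upwards [hae η] with x hx
    rw [← mul_cutoffResolvent hx, NNReal.smul_def, Complex.real_smul]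
    push_cast
    rw [← Complex.conj_mul']
    ring

theorem isSpectralMeasure_spectralMeasure (hB : IsSelfAdjoint B) {z : ℂ} (hz : z ∈ resolventSet B) :
    IsSpectralMeasure B (spectralMeasure B) := by
  have h := exists_isSpectralMeasure hB hz
  unfold spectralMeasure
  exact (dif_pos h).symm ▸ h.choose_spec

end SpectralTheorem

/-! ### Unitary groups -/

namespace ProjectionValuedMeasure

variable (E : ProjectionValuedMeasure H)

/-- The unitary group `∫ e^{iλt} dE_λ`. -/
def group (t : ℝ) : H →L[ℂ] H := E.integral fun x => Complex.exp (Complex.I * x * t)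

theorem norm_exp_I_mul_mul (x t : ℝ) : ‖Complex.exp (Complex.I * x * t)‖ = 1 := by
  rw [mul_assoc, ← Complex.ofReal_mul, mul_comm, Complex.norm_exp_ofReal_mul_I]

theorem isBddMeasurable_exp (t : ℝ) :
    IsBddMeasurable fun x : ℝ => Complex.exp (Complex.I * x * t) :=
  ⟨by fun_prop, 1, fun x => (norm_exp_I_mul_mul x t).le⟩

theorem group_add (s t : ℝ) : E.group (s + t) = E.group s * E.group t := by
  rw [group, group, group, ← E.integral_mul (isBddMeasurable_exp s) (isBddMeasurable_exp t)]
  congr 1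
  ext x
  rw [← Complex.exp_add]
  push_cast
  ring_nf

theorem group_add_apply (s t : ℝ) (φ : H) : E.group (s + t) φ = E.group s (E.group t φ) := by
  rw [E.group_add, mul_apply_eq_comp]

theorem group_zero : E.group 0 = 1 := by
  rw [← E.integral_one, group]
  simp

theorem star_group (t : ℝ) : star (E.group t) = E.group (-t) := by
  rw [group, group, ← E.integral_conj (isBddMeasurable_exp t)]
  congr 1
  ext x
  rw [← Complex.exp_conj]
  simp

theorem inner_group_left (t : ℝ) (φ ψ : H) : ⟪E.group t φ, ψ⟫_ℂ = ⟪φ, E.group (-t) ψ⟫_ℂ := by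
  rw [← E.star_group, ContinuousLinearMap.star_eq_adjoint,
    ContinuousLinearMap.adjoint_inner_right]

/-- Unimodular functions leave the scalar measure unchanged, hence preserve everything read off from
it: the norm, the domain of B and the quadratic form of B. -/
theorem scalarMeasure_integral_of_norm_eq_one {f : ℝ → ℂ} (hf : IsBddMeasurable f)
    (h1 : ∀ x, ‖f x‖ = 1) (φ : H) : E.scalarMeasure (E.integral f φ) = E.scalarMeasure φ := by
  rw [E.scalarMeasure_integral_apply hf]
  have : (fun x => ‖f x‖ₑ ^ 2) = 1 := by
    ext x
    rw [← ofReal_norm, h1]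
    simp
  rw [this, withDensity_one]

theorem scalarMeasure_group (t : ℝ) (φ : H) :
    E.scalarMeasure (E.group t φ) = E.scalarMeasure φ :=
  E.scalarMeasure_integral_of_norm_eq_one (isBddMeasurable_exp t)
    (fun x => norm_exp_I_mul_mul x t) φ

theorem norm_group_apply (t : ℝ) (φ : H) : ‖E.group t φ‖ = ‖φ‖ := by
  have h := E.scalarMeasure_univ (E.group t φ)
  rw [E.scalarMeasure_group, E.scalarMeasure_univ,
    ENNReal.ofReal_eq_ofReal_iff (by positivity) (by positivity)] at h
  exact ((pow_left_inj₀ (norm_nonneg _) (norm_nonneg _) two_ne_zero).1 h).symm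

theorem inner_self_group (t : ℝ) (φ : H) :
    ⟪φ, E.group t φ⟫_ℂ = ∫ x, Complex.exp (Complex.I * x * t) ∂(E.scalarMeasure φ) :=
  E.hasForm_integral (isBddMeasurable_exp t) φ

theorem continuous_inner_self_group (φ : H) : Continuous fun t => ⟪φ, E.group t φ⟫_ℂ := by
  simp_rw [E.inner_self_group]
  refine continuous_of_dominated (bound := fun _ => 1)
    (fun t => (isBddMeasurable_exp t).measurable.aestronglyMeasurable)
    (fun t => Eventually.of_forall fun x => (norm_exp_I_mul_mul x t).le) (integrable_const _)
    (Eventually.of_forall fun x => by fun_prop)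

/-- For isometries the squared distance of two orbit points is an affine function of Re⟨φ, U(s −
t)φ⟩, so weak continuity suffices. -/
theorem continuous_group_apply (φ : H) : Continuous fun t => E.group t φ := by
  rw [continuous_iff_continuousAt]
  intro s
  rw [ContinuousAt, tendsto_iff_norm_sub_tendsto_zero]
  have h (t : ℝ) : ‖E.group t φ - E.group s φ‖ ^ 2 =
      2 * ‖φ‖ ^ 2 - 2 * (⟪φ, E.group (s - t) φ⟫_ℂ).re := by
    rw [norm_sub_sq (𝕜 := ℂ), E.norm_group_apply, E.norm_group_apply, E.inner_group_left,
      ← E.group_add_apply, neg_add_eq_sub]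
    simp only [RCLike.re_to_complex]
    ring
  have h0 : Tendsto (fun t => ‖E.group t φ - E.group s φ‖ ^ 2) (𝓝 s) (𝓝 0) := by
    simp_rw [h]
    have hc : Continuous fun t => 2 * ‖φ‖ ^ 2 - 2 * (⟪φ, E.group (s - t) φ⟫_ℂ).re := by
      have := (E.continuous_inner_self_group φ).comp (continuous_sub_left s)
      have h3 := Complex.continuous_re.comp this
      exact continuous_const.sub (continuous_const.mul h3)
    have h4 := hc.tendsto s
    rw [sub_self, E.group_zero, one_apply_eq_self, inner_self_eq_norm_sq_to_K] at h4
    simpa [← Complex.ofReal_pow] using h4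
  have h1 := h0.sqrt
  simpa only [Real.sqrt_sq (norm_nonneg _), Real.sqrt_zero] using h1

end ProjectionValuedMeasure

/-! ### The spectral group: its generator, and commutation with the resolvent. -/

section Generator

variable {B : H →ₗ.[ℂ] H} {E : ProjectionValuedMeasure H}

theorem IsSpectralMeasure.group_mem_domain (hE : IsSpectralMeasure B E) (t : ℝ) {φ : H}
    (hφ : φ ∈ B.domain) : E.group t φ ∈ B.domain := by
  rw [hE.1, E.scalarMeasure_group, ← hE.1]
  exact hφ

theorem IsSpectralMeasure.integrable_id (hE : IsSpectralMeasure B E) {φ : H}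
    (hφ : φ ∈ B.domain) : Integrable (fun x : ℝ => x) (E.scalarMeasure φ) := by
  have h : Integrable (fun x : ℝ => x ^ 2) (E.scalarMeasure φ) := by
    refine ⟨by fun_prop, ?_⟩
    rw [hasFiniteIntegral_iff_ofReal (Eventually.of_forall fun x => by positivity)]
    exact (hE.1 φ).1 hφ
  refine (h.add (integrable_const 1)).mono' (by fun_prop) (Eventually.of_forall fun x => ?_)
  simp only [Pi.add_apply, Real.norm_eq_abs]
  nlinarith [sq_nonneg (|x| - 1), sq_abs x, abs_nonneg x]

/-- Dominated convergence: the difference quotients of e^{iλh} are bounded by |λ|, which is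
integrable for φ in the domain. -/
theorem IsSpectralMeasure.tendsto_inner_self_slope (hE : IsSpectralMeasure B E) (φ : B.domain) :
    Tendsto (fun h : ℝ => ⟪(φ : H), (h : ℂ)⁻¹ • (E.group h φ - (φ : H))⟫_ℂ) (𝓝[≠] 0)
      (𝓝 ⟪(φ : H), Complex.I • B φ⟫_ℂ) := by
  have e1 (h : ℝ) : ⟪(φ : H), (h : ℂ)⁻¹ • (E.group h φ - (φ : H))⟫_ℂ =
      ∫ x : ℝ, (h : ℂ)⁻¹ * (Complex.exp (Complex.I * x * h) - 1) ∂(E.scalarMeasure (φ : H)) := by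
    rw [MeasureTheory.integral_const_mul, inner_smul_right, inner_sub_right, E.inner_self_group,
      MeasureTheory.integral_sub
        ((ProjectionValuedMeasure.isBddMeasurable_exp h).integrable _) (integrable_const 1)]
    congr 2
    rw [← HasForm.one E.scalarMeasure_univ (φ : H)]
    rfl
  have e2 : ⟪(φ : H), Complex.I • B φ⟫_ℂ =
      ∫ x : ℝ, Complex.I * x ∂(E.scalarMeasure (φ : H)) := by
    rw [MeasureTheory.integral_const_mul, inner_smul_right, hE.2]
  simp_rw [e1]
  rw [e2]
  refine tendsto_integral_filter_of_dominated_convergence (fun x => |x|)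
    (Eventually.of_forall fun h => by fun_prop) ?_ (hE.integrable_id φ.2).abs
    (Eventually.of_forall fun x => ?_)
  · filter_upwards [self_mem_nhdsWithin] with h hh
    refine Eventually.of_forall fun x => ?_
    have hh' : 0 < |h| := abs_pos.2 hh
    rw [norm_mul, norm_inv, Complex.norm_real, Real.norm_eq_abs, inv_mul_le_iff₀ hh']
    have := Real.norm_exp_I_mul_ofReal_sub_one_le (x := x * h)
    rw [Complex.ofReal_mul, ← mul_assoc, Real.norm_eq_abs, abs_mul, mul_comm |x|] at this
    exact this
  · have hd : HasDerivAt (fun h : ℝ => Complex.exp (Complex.I * x * h)) (Complex.I * x) 0 := by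
      have h1 : HasDerivAt (fun h : ℝ => Complex.I * x * h) (Complex.I * x * 1) 0 :=
        (Complex.ofRealCLM.hasDerivAt (x := (0 : ℝ))).const_mul (Complex.I * x)
      simpa using h1.cexp
    have h2 := hd.tendsto_slope_zero
    refine h2.congr fun h => ?_
    simp

theorem IsSpectralMeasure.tendsto_inner_slope (hE : IsSpectralMeasure B E) (ψ φ : B.domain) :
    Tendsto (fun h : ℝ => ⟪(ψ : H), (h : ℂ)⁻¹ • (E.group h φ - (φ : H))⟫_ℂ) (𝓝[≠] 0)
      (𝓝 ⟪(ψ : H), Complex.I • B φ⟫_ℂ) :=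
  tendsto_inner_map_of_forall_self (S := B.domain.subtype)
    (T := fun h : ℝ => (h : ℂ)⁻¹ • (((E.group h : H →ₗ[ℂ] H) ∘ₗ B.domain.subtype)
      - B.domain.subtype))
    (T₀ := Complex.I • B.toFun) hE.tendsto_inner_self_slope ψ φ

theorem IsSpectralMeasure.hasDerivAt_inner (hE : IsSpectralMeasure B E) (ψ φ : B.domain) (t : ℝ) :
    HasDerivAt (fun t => ⟪(ψ : H), E.group t φ⟫_ℂ) ⟪(ψ : H), Complex.I • E.group t (B φ)⟫_ℂ t := by
  rw [hasDerivAt_iff_tendsto_slope_zero]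
  have h := hE.tendsto_inner_slope ⟨E.group (-t) ψ, hE.group_mem_domain (-t) ψ.2⟩ φ
  simp only [E.inner_group_left, neg_neg] at h
  rw [map_smul] at h
  refine h.congr fun s => ?_
  rw [map_smul, map_sub, ← E.group_add_apply, inner_smul_right, inner_sub_right, Complex.real_smul,
    Complex.ofReal_inv]

/-- The weak derivative is a strongly continuous curve. Its integral F is strongly differentiable
and agrees with the orbit when tested on the dense domain, so the two coincide. -/
theorem IsSpectralMeasure.hasDerivAt (hE : IsSpectralMeasure B E)
    (hd : Dense (B.domain : Set H)) (φ : B.domain) (t : ℝ) :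
    HasDerivAt (fun t => E.group t φ) (Complex.I • E.group t (B φ)) t := by
  have hc : Continuous fun t => Complex.I • E.group t (B φ) :=
    (E.continuous_group_apply (B φ)).const_smul _
  let F : ℝ → H := fun t => (φ : H) + ∫ s in (0 : ℝ)..t, Complex.I • E.group s (B φ)
  have hF (t : ℝ) : HasDerivAt F (Complex.I • E.group t (B φ)) t :=
    (intervalIntegral.integral_hasDerivAt_right (hc.intervalIntegrable _ _)
      (hc.stronglyMeasurableAtFilter _ _) hc.continuousAt).const_add _
  have heq : (fun t => E.group t φ) = F := by
    ext t
    refine hd.eq_of_inner_right (𝕜 := ℂ) fun ψ hψ => ?_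
    have h1 (t : ℝ) : HasDerivAt (fun t => ⟪ψ, E.group t φ⟫_ℂ - ⟪ψ, F t⟫_ℂ) 0 t := by
      have h2 := ((innerSL ℂ ψ).restrictScalars ℝ).hasFDerivAt.comp_hasDerivAt t (hF t)
      have h3 := (hE.hasDerivAt_inner ⟨ψ, hψ⟩ φ t).sub h2
      exact h3.congr_deriv (sub_self _)
    have h4 := is_const_of_deriv_eq_zero (fun t => (h1 t).differentiableAt)
      (fun t => (h1 t).deriv) t 0
    simp only [F, E.group_zero, one_apply_eq_self, intervalIntegral.integral_same, add_zero,
      sub_self] at h4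
    exact sub_eq_zero.1 h4
  rw [heq]
  exact hF t

theorem IsSpectralMeasure.integral_mem_domain (hE : IsSpectralMeasure B E) {f : ℝ → ℂ}
    (hf : IsBddMeasurable f) (h1 : ∀ x, ‖f x‖ = 1) {φ : H} (hφ : φ ∈ B.domain) :
    E.integral f φ ∈ B.domain := by
  rw [hE.1, E.scalarMeasure_integral_of_norm_eq_one hf h1, ← hE.1]
  exact hφ

/-- The unitary V = ∫ f dE preserves the domain and the quadratic form of B, so by polarization V⋆BV
= B. This needs only the defining properties of E, not a formula for the resolvent as a spectral
integral. -/
theorem IsSpectralMeasure.commute_resolvent (hE : IsSpectralMeasure B E)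
    (hd : Dense (B.domain : Set H)) {f : ℝ → ℂ}
    (hf : IsBddMeasurable f) (h1 : ∀ x, ‖f x‖ = 1) {z : ℂ} {R : H →L[ℂ] H}
    (hR : IsResolventAt B z R) : Commute R (E.integral f) := by
  set V := E.integral f with hV
  have hfc (x : ℝ) : f x * starRingEnd ℂ (f x) = 1 := by
    rw [Complex.mul_conj', h1]
    simp
  have hVV : V * star V = 1 := by
    rw [hV, ← E.integral_conj hf, ← E.integral_mul hf hf.conj, ← E.integral_one]
    simp_rw [hfc]
  have hmem (φ : B.domain) : V φ ∈ B.domain := hE.integral_mem_domain hf h1 φ.2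
  let VD : B.domain →ₗ[ℂ] B.domain :=
    ((V : H →ₗ[ℂ] H) ∘ₗ B.domain.subtype).codRestrict B.domain hmem
  let T : B.domain →ₗ[ℂ] H := ((star V : H →L[ℂ] H) : H →ₗ[ℂ] H) ∘ₗ B.toFun ∘ₗ VD - B.toFun
  have hT (φ : B.domain) : T φ = star V (B (VD φ)) - B φ := rfl
  have hq (φ : B.domain) : ⟪B.domain.subtype φ, T φ⟫_ℂ = 0 := by
    rw [hT, inner_sub_right, Submodule.subtype_apply, ContinuousLinearMap.star_eq_adjoint,
      ContinuousLinearMap.adjoint_inner_right, hE.2 φ]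
    have h2 := hE.2 (VD φ)
    have h3 : ((VD φ : B.domain) : H) = V φ := rfl
    rw [h3, E.scalarMeasure_integral_of_norm_eq_one hf h1] at h2
    rw [h2, sub_self]
  have hT0 (φ : B.domain) : T φ = 0 := by
    refine hd.eq_of_inner_right (𝕜 := ℂ) fun ψ hψ => ?_
    rw [inner_zero_right]
    exact inner_map_eq_zero_of_forall_self hq ⟨ψ, hψ⟩ φ
  have hcomm (φ : B.domain) : B (VD φ) = V (B φ) := by
    have h2 := congrArg V (sub_eq_zero.1 ((hT φ).symm.trans (hT0 φ)))
    rwa [← mul_apply_eq_comp, hVV, one_apply_eq_self] at h2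
  rw [commute_iff_eq]
  ext ψ
  have h2 := hR.2 (VD ⟨R ψ, hR.mem_domain ψ⟩)
  rw [hcomm, hR.apply] at h2
  have h3 : ((VD ⟨R ψ, hR.mem_domain ψ⟩ : B.domain) : H) = V (R ψ) := rfl
  rw [h3] at h2
  simp only [map_add, map_smul, add_sub_cancel_right] at h2
  exact h2

theorem IsSpectralMeasure.commute_resolvent_proj (hE : IsSpectralMeasure B E)
    (hd : Dense (B.domain : Set H)) {S : Set ℝ} (hS : MeasurableSet S) {z : ℂ} {R : H →L[ℂ] H}
    (hR : IsResolventAt B z R) : Commute R (E.proj S) := by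
  have hi : IsBddMeasurable (S.indicator fun _ => (1 : ℂ)) :=
    (IsBddMeasurable.const 1).indicator hS
  -- The function 2·1_S − 1 takes the values ±1, so the unimodular case applies to 2E(S) − 1.
  have hb := ((IsBddMeasurable.const 2).mul hi).add (IsBddMeasurable.const (-1))
  have h := hE.commute_resolvent hd hb (fun x => by
    by_cases hx : x ∈ S
    · simp only [Set.indicator_of_mem hx]; norm_num
    · simp [hx]) hR
  have hm1 : E.integral (fun _ => (-1 : ℂ)) = -1 := by
    have := E.integral_const_mul (-1) (IsBddMeasurable.const 1)
    simpa [E.integral_one] using this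
  rw [E.integral_add ((IsBddMeasurable.const 2).mul hi) (IsBddMeasurable.const (-1)),
    E.integral_const_mul 2 hi, E.integral_indicator_one hS, hm1] at h
  have h2 : Commute R ((2 : ℂ) • E.proj S) := by
    simpa using h.add_right (Commute.one_right R)
  have h3 := h2.smul_right (2 : ℂ)⁻¹
  rwa [smul_smul, inv_mul_cancel₀ two_ne_zero, one_smul] at h3

end Generator

/-! ### The absolutely continuous subspace -/

namespace ProjectionValuedMeasure

variable (E : ProjectionValuedMeasure H)

theorem mem_acSubspace_iff {φ : H} : φ ∈ E.acSubspace ↔ E.scalarMeasure φ ≪ volume := Iff.rfl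

theorem group_mem_acSubspace (t : ℝ) {φ : H} (hφ : φ ∈ E.acSubspace) :
    E.group t φ ∈ E.acSubspace := by
  rw [mem_acSubspace_iff, E.scalarMeasure_group]
  exact hφ

theorem map_mem_acSubspace {Q : H →L[ℂ] H}
    (hQ : ∀ S, MeasurableSet S → Commute Q (E.proj S)) {φ : H} (hφ : φ ∈ E.acSubspace) :
    Q φ ∈ E.acSubspace :=
  (E.absolutelyContinuous_iff _).2 fun S hS h0 => by
    have h := (E.absolutelyContinuous_iff φ).1 hφ S hS h0
    rw [← mul_apply_eq_comp, ← (hQ S hS).eq, mul_apply_eq_comp, h, map_zero]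

theorem acProj_mem (φ : H) : E.acProj φ ∈ E.acSubspace :=
  E.acSubspace.starProjection_apply_mem φ

theorem inner_acProj_left (x : H) {φ : H} (hφ : φ ∈ E.acSubspace) :
    ⟪E.acProj x, φ⟫_ℂ = ⟪x, φ⟫_ℂ := by
  have h := E.acSubspace.starProjection_inner_eq_zero x φ hφ
  rw [inner_sub_left, sub_eq_zero] at h
  exact h.symm

/-- Let v be orthogonal to the image and P the projection onto the subspace. Q⋆Pv stays in the
subspace, so ‖Q⋆Pv‖² = ⟨v, QQ⋆Pv⟩ = 0; injectivity gives Pv = 0, and v is orthogonal to the whole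
subspace. -/
theorem acSubspace_le_closure_map {Q : H →L[ℂ] H}
    (hQ : ∀ S, MeasurableSet S → Commute Q (E.proj S))
    (hinj : Function.Injective (star Q : H →L[ℂ] H)) :
    (E.acSubspace : Set H) ⊆ closure (Q '' E.acSubspace) := by
  intro φ hφ
  have hQ' S (hS : MeasurableSet S) : Commute (star Q) (E.proj S) := by
    have := (hQ S hS).star_star
    rwa [E.star_proj hS] at this
  have key : φ ∈ (E.acSubspace.map (Q : H →ₗ[ℂ] H)).topologicalClosure := by
    rw [← Submodule.orthogonal_orthogonal_eq_closure, Submodule.mem_orthogonal]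
    intro v hv
    rw [← E.inner_acProj_left v hφ]
    have h1 : star Q (E.acProj v) = 0 := by
      have hm := E.map_mem_acSubspace hQ' (E.acProj_mem v)
      rw [← inner_self_eq_zero (𝕜 := ℂ), ContinuousLinearMap.star_eq_adjoint,
        ContinuousLinearMap.adjoint_inner_left, ← ContinuousLinearMap.star_eq_adjoint,
        E.inner_acProj_left v (E.map_mem_acSubspace hQ hm)]
      exact (Submodule.mem_orthogonal' _ _).1 hv _ (Submodule.mem_map_of_mem hm)
    rw [hinj (h1.trans (map_zero (star Q)).symm), inner_zero_left]
  exact key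

theorem proj_compl {S : Set ℝ} (hS : MeasurableSet S) : E.proj Sᶜ = 1 - E.proj S := by
  have h1 : HasForm E.scalarMeasure (Sᶜ.indicator fun _ => 1) (E.proj Sᶜ) := by
    simpa using E.hasForm_indicator 1 hS.compl
  have h2 : HasForm E.scalarMeasure (S.indicator fun _ => 1) (E.proj S) := by
    simpa using E.hasForm_indicator 1 hS
  refine h1.unique ?_
  convert (HasForm.one E.scalarMeasure_univ).sub E.scalarMeasure_univ (IsBddMeasurable.const 1)
    ((IsBddMeasurable.const 1).indicator hS) h2 using 1
  ext x
  by_cases hx : x ∈ S <;> simp [hx]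

theorem scalarMeasure_proj_apply (φ : H) {S : Set ℝ} (hS : MeasurableSet S) :
    E.scalarMeasure (E.proj S φ) = (E.scalarMeasure φ).restrict S := by
  ext S' hS'
  rw [Measure.restrict_apply hS', ← E.enorm_sq_proj _ hS', ← E.enorm_sq_proj _ (hS'.inter hS),
    E.proj_inter _ _ hS' hS, mul_apply_eq_comp]

/-- Vectors whose scalar spectral measure has a bounded density. -/
def boundedDensity : Set H :=
  {φ | ∃ f : ℝ → ℂ, MemLp f ∞ volume ∧
    E.scalarMeasure φ = volume.withDensity fun x => ‖f x‖ₑ ^ 2}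

theorem boundedDensity_subset : E.boundedDensity ⊆ E.acSubspace := by
  rintro φ ⟨f, -, h⟩
  have : E.scalarMeasure φ ≪ volume := h ▸ withDensity_absolutelyContinuous _ _
  exact this

/-- Projecting to the set where the density w is at most n restricts the measure to it; f = √w there
is bounded by √n. -/
theorem proj_mem_boundedDensity {φ : H} (hφ : φ ∈ E.acSubspace) (n : ℕ) :
    E.proj {x | (E.scalarMeasure φ).rnDeriv volume x ≤ n} φ ∈ E.boundedDensity := by
  set w := (E.scalarMeasure φ).rnDeriv volume with hw
  have hwm : Measurable w := Measure.measurable_rnDeriv _ _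
  set S := {x | w x ≤ n} with hS
  have hSm : MeasurableSet S := measurableSet_le hwm measurable_const
  have hfin (x : ℝ) (hx : x ∈ S) : w x ≠ ∞ := ne_top_of_le_ne_top (ENNReal.natCast_ne_top n) hx
  let f : ℝ → ℂ := S.indicator fun x => ((√(w x).toReal : ℝ) : ℂ)
  have hfm : Measurable f := by
    refine Measurable.indicator ?_ hSm
    fun_prop
  refine ⟨f, memLp_top_of_bound hfm.aestronglyMeasurable (√n)
    (Eventually.of_forall fun x => ?_), ?_⟩
  · by_cases hx : x ∈ S
    · simp only [f, Set.indicator_of_mem hx, Complex.norm_real, Real.norm_eq_abs,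
        abs_of_nonneg (Real.sqrt_nonneg _)]
      refine Real.sqrt_le_sqrt ?_
      exact ENNReal.toReal_le_of_le_ofReal (by positivity)
        (by rw [ENNReal.ofReal_natCast]; exact hx)
    · simp [f, Set.indicator_of_notMem hx]
  · rw [E.scalarMeasure_proj_apply φ hSm, ← Measure.withDensity_rnDeriv_eq _ _ hφ,
      restrict_withDensity hSm, ← withDensity_indicator hSm]
    congr 1
    ext x
    by_cases hx : x ∈ S
    · simp only [f, Set.indicator_of_mem hx]
      rw [← ofReal_norm, Complex.norm_real, Real.norm_eq_abs, abs_of_nonneg (Real.sqrt_nonneg _),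
        ← ENNReal.ofReal_pow (Real.sqrt_nonneg _), Real.sq_sqrt ENNReal.toReal_nonneg,
        ENNReal.ofReal_toReal (hfin x hx)]
    · simp [f, Set.indicator_of_notMem hx]

/-- The squared truncation error is the measure of {w > n}, which decreases to that of the null set
{w = ∞}. -/
theorem acSubspace_subset_closure_boundedDensity :
    (E.acSubspace : Set H) ⊆ closure E.boundedDensity := by
  intro φ hφ
  set w := (E.scalarMeasure φ).rnDeriv volume with hw
  have hwm : Measurable w := Measure.measurable_rnDeriv _ _
  have hSm (n : ℕ) : MeasurableSet {x | w x ≤ n} := measurableSet_le hwm measurable_const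
  refine mem_closure_of_tendsto (f := fun n : ℕ => E.proj {x | w x ≤ n} φ) (b := atTop) ?_
    (Eventually.of_forall (E.proj_mem_boundedDensity hφ))
  have h1 : Tendsto (fun n : ℕ => E.scalarMeasure φ {x | w x ≤ n}ᶜ) atTop
      (𝓝 (E.scalarMeasure φ (⋂ n : ℕ, {x | w x ≤ n}ᶜ))) := by
    refine tendsto_measure_iInter_atTop (fun n => (hSm n).compl.nullMeasurableSet) ?_
      ⟨0, measure_ne_top _ _⟩
    intro m n hmn x hx
    simp only [Set.mem_compl_iff, Set.mem_ofPred_eq, not_le] at hx ⊢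
    exact lt_of_le_of_lt (by exact_mod_cast hmn) hx
  have h2 : E.scalarMeasure φ (⋂ n : ℕ, {x | w x ≤ n}ᶜ) = 0 := by
    refine hφ (measure_mono_null (fun x hx => ?_) (ae_iff.1
      (Measure.rnDeriv_lt_top (E.scalarMeasure φ) volume)))
    simp only [Set.mem_iInter, Set.mem_compl_iff, Set.mem_ofPred_eq, not_le] at hx
    simp only [Set.mem_ofPred_eq, not_lt, top_le_iff]
    exact ENNReal.eq_top_of_forall_nnreal_le fun r =>
      ((by exact_mod_cast (Nat.le_ceil r) : (r : ℝ≥0∞) ≤ (⌈r⌉₊ : ℕ)).trans (hx _).le)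
  rw [h2] at h1
  have h3 (n : ℕ) : E.scalarMeasure φ {x | w x ≤ n}ᶜ =
      ENNReal.ofReal (‖E.proj {x | w x ≤ n} φ - φ‖ ^ 2) := by
    rw [← E.enorm_sq_proj φ (hSm n).compl, E.proj_compl (hSm n), sub_apply, one_apply_eq_self,
      ← ofReal_norm, ← ENNReal.ofReal_pow (norm_nonneg _), norm_sub_rev]
  simp_rw [h3] at h1
  have h4 := (ENNReal.tendsto_toReal ENNReal.zero_ne_top).comp h1
  have h5 := h4.sqrt
  rw [tendsto_iff_norm_sub_tendsto_zero]
  simpa [Function.comp_def, ENNReal.toReal_ofReal, Real.sqrt_sq] using h5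

/-- Riemann–Lebesgue: the matrix element is the Fourier transform, at frequency t/2π, of the
spectral density. -/
theorem tendsto_inner_self_group {φ : H} (hφ : φ ∈ E.acSubspace) :
    Tendsto (fun t : ℝ => ⟪φ, E.group (-t) φ⟫_ℂ) atTop (𝓝 0) := by
  have h := (Real.tendsto_integral_exp_smul_cocompact fun x =>
    ((((E.scalarMeasure φ).rnDeriv volume x).toReal : ℝ) : ℂ)).comp
      ((tendsto_id.atTop_div_const Real.two_pi_pos).mono_right atTop_le_cocompact)
  refine h.congr fun t => ?_
  rw [E.inner_self_group, ← integral_rnDeriv_smul (show E.scalarMeasure φ ≪ volume from hφ)]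
  refine MeasureTheory.integral_congr_ae (Eventually.of_forall fun x => ?_)
  simp only [id_eq, Circle.smul_def, Real.fourierChar_apply, smul_eq_mul, Complex.real_smul]
  rw [mul_comm]
  congr 2
  push_cast
  have : (Real.pi : ℂ) ≠ 0 := by exact_mod_cast Real.pi_ne_zero
  field_simp

/-- The group leaves the absolutely continuous subspace invariant, so x may be replaced by its
projection there and the diagonal case polarized. -/
theorem tendsto_inner_group (x : H) {φ : H} (hφ : φ ∈ E.acSubspace) :
    Tendsto (fun t : ℝ => ⟪x, E.group (-t) φ⟫_ℂ) atTop (𝓝 0) := by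
  have h := tendsto_inner_map_of_forall_self (l := atTop) (S := E.acSubspace.subtype)
    (T := fun t : ℝ => (E.group (-t) : H →ₗ[ℂ] H) ∘ₗ E.acSubspace.subtype)
    (T₀ := 0) (fun y => by simpa using E.tendsto_inner_self_group y.2)
    ⟨E.acProj x, E.acProj_mem x⟩ ⟨φ, hφ⟩
  simp only [LinearMap.zero_apply, inner_zero_right] at h
  refine h.congr fun t => ?_
  exact E.inner_acProj_left x (E.group_mem_acSubspace (-t) hφ)

end ProjectionValuedMeasure

/-! ### Square integrability of matrix elements of unitary groups -/

open FourierTransform in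
/-- Plancherel's theorem for functions in `L¹ ∩ L²`. -/
theorem lintegral_enorm_sq_fourier {h : ℝ → ℂ} (h1 : Integrable h) (h2 : MemLp h 2 volume) :
    ∫⁻ ξ, ‖𝓕 h ξ‖ₑ ^ 2 = ∫⁻ t, ‖h t‖ₑ ^ 2 := by
  let u : Lp ℂ 2 (volume : Measure ℝ) := h2.toLp h
  have hcont : Continuous (𝓕 h) := VectorFourier.fourierIntegral_continuous
    Real.continuous_fourierChar (by exact continuous_inner) h1
  -- The integral and L² transforms agree almost everywhere: against a smooth compactly supported
  -- function, both shift the transform onto the test function.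
  have key : ∀ᵐ ξ : ℝ, 𝓕 h ξ = (𝓕 u : Lp ℂ 2 (volume : Measure ℝ)) ξ := by
    refine ae_eq_of_integral_contDiff_smul_eq hcont.locallyIntegrable
      ((Lp.memLp _).locallyIntegrable (by norm_num)) fun g hg hgc => ?_
    let G : SchwartzMap ℝ ℂ := (hgc.comp_left Complex.ofReal_zero).toSchwartzMap
      (Complex.ofRealCLM.contDiff.comp hg)
    have hG (x : ℝ) : G x = (g x : ℂ) := rfl
    have e1 := congrArg (fun D => D G) (Lp.fourier_toTemperedDistribution_eq u)
    simp only [TemperedDistribution.fourier_apply, Lp.toTemperedDistribution_apply] at e1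
    have e2 : ∫ x, g x • (𝓕 u : Lp ℂ 2 (volume : Measure ℝ)) x = ∫ x, 𝓕 G x • u x := by
      rw [e1]
      rfl
    rw [e2]
    have e3 : ∫ x, 𝓕 G x • u x = ∫ x, 𝓕 (G : ℝ → ℂ) x • h x := by
      refine integral_congr_ae ?_
      filter_upwards [h2.coeFn_toLp] with x hx
      rw [hx]
      rfl
    rw [e3]
    have e4 := VectorFourier.integral_fourierIntegral_smul_eq_flip (L := innerₗ ℝ)
      (μ := volume) (ν := volume) Real.continuous_fourierChar (by exact continuous_inner)
      G.integrable h1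
    rw [flip_innerₗ] at e4
    exact e4.symm
  have e5 := Lp.norm_fourier_eq u
  have e6 (f : Lp ℂ 2 (volume : Measure ℝ)) : ‖f‖ₑ ^ 2 = ∫⁻ x, ‖f x‖ₑ ^ 2 := by
    rw [Lp.enorm_def, eLpNorm_eq_lintegral_rpow_enorm_toReal (by norm_num) (by norm_num)]
    simp only [ENNReal.toReal_ofNat, ENNReal.rpow_ofNat, one_div]
    rw [← ENNReal.rpow_natCast, ← ENNReal.rpow_mul]
    norm_num
  have e7 : ‖(𝓕 u : Lp ℂ 2 (volume : Measure ℝ))‖ₑ = ‖u‖ₑ := by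
    rw [← ofReal_norm, e5, ofReal_norm]
  have e8 := congrArg (· ^ 2) e7
  simp only [e6] at e8
  rw [lintegral_congr_ae (key.mono fun x hx => by rw [hx]), e8]
  exact lintegral_congr_ae (h2.coeFn_toLp.mono fun x hx => by simp only [u, hx])

namespace ProjectionValuedMeasure

variable (E : ProjectionValuedMeasure H)

/-- The Fourier transform `∫ h(t) e^{-iλt} dt`. -/
def expTransform (h : ℝ → ℂ) (x : ℝ) : ℂ :=
  ∫ t : ℝ, h t * Complex.exp (Complex.I * x * ((-t : ℝ) : ℂ))

open FourierTransform in
theorem expTransform_eq_fourier (h : ℝ → ℂ) (x : ℝ) :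
    expTransform h x = 𝓕 h (x * (2 * Real.pi)⁻¹) := by
  rw [expTransform, Real.fourier_eq]
  congr 1
  ext t
  rw [Circle.smul_def, Real.fourierChar_apply, smul_eq_mul, mul_comm]
  congr 2
  simp only [RCLike.inner_apply, conj_trivial]
  push_cast
  have : (Real.pi : ℂ) ≠ 0 := by exact_mod_cast Real.pi_ne_zero
  field_simp

/-- The factor 2π is the Jacobian of ξ = x/2π in Plancherel's theorem. -/
theorem lintegral_enorm_sq_expTransform {h : ℝ → ℂ} (h1 : Integrable h)
    (h2 : MemLp h 2 volume) :
    ∫⁻ x, ‖expTransform h x‖ₑ ^ 2 = ENNReal.ofReal (2 * Real.pi) * ∫⁻ t, ‖h t‖ₑ ^ 2 := by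
  have hpi := Real.two_pi_pos
  simp_rw [expTransform_eq_fourier]
  have hm : MeasurableEmbedding fun x : ℝ => x * (2 * Real.pi)⁻¹ :=
    (Homeomorph.mulRight₀ _ (inv_ne_zero hpi.ne')).measurableEmbedding
  rw [← lintegral_enorm_sq_fourier h1 h2,
    ← hm.lintegral_map (fun ξ => ‖FourierTransform.fourier h ξ‖ₑ ^ 2),
    Real.map_volume_mul_right (inv_ne_zero hpi.ne'), lintegral_smul_measure, inv_inv,
    abs_of_pos hpi]
  rfl

theorem norm_mul_exp (a : ℂ) (x t : ℝ) :
    ‖a * Complex.exp (Complex.I * x * ((-t : ℝ) : ℂ))‖ = ‖a‖ := by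
  rw [norm_mul, norm_exp_I_mul_mul, mul_one]

theorem isBddMeasurable_expTransform {h : ℝ → ℂ} (h1 : Integrable h) :
    IsBddMeasurable (expTransform h) := by
  refine ⟨Continuous.measurable ?_, ∫ t, ‖h t‖, fun x => ?_⟩
  · refine continuous_of_dominated (bound := fun t => ‖h t‖)
      (fun x => h1.aestronglyMeasurable.mul (by fun_prop))
      (fun x => Eventually.of_forall fun t => (norm_mul_exp _ _ _).le) h1.norm
      (Eventually.of_forall fun t => by fun_prop)
  · refine (norm_integral_le_integral_norm _).trans_eq ?_
    simp_rw [norm_mul_exp]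

theorem integrable_mul_inner_group {h : ℝ → ℂ} (h1 : Integrable h) (y φ : H) :
    Integrable fun t => h t * ⟪y, E.group (-t) φ⟫_ℂ := by
  refine h1.mul_bdd (c := ‖y‖ * ‖φ‖) ?_ (Eventually.of_forall fun t => ?_)
  · exact (continuous_const.inner
      ((E.continuous_group_apply φ).comp continuous_neg)).aestronglyMeasurable
  · exact (norm_inner_le_norm _ _).trans_eq (by rw [E.norm_group_apply])

theorem inner_self_integral_expTransform {h : ℝ → ℂ} (h1 : Integrable h) (φ : H) :
    ⟪φ, E.integral (expTransform h) φ⟫_ℂ = ∫ t, h t * ⟪φ, E.group (-t) φ⟫_ℂ := by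
  rw [E.hasForm_integral (isBddMeasurable_expTransform h1) φ]
  simp_rw [E.inner_self_group, ← MeasureTheory.integral_const_mul]
  unfold expTransform
  refine integral_integral_swap ?_
  have := (h1.comp_snd (E.scalarMeasure φ)).mul_bdd (c := 1)
    (g := fun p : ℝ × ℝ => Complex.exp (Complex.I * p.1 * ((-p.2 : ℝ) : ℂ)))
    (Continuous.aestronglyMeasurable (by fun_prop))
    (Eventually.of_forall fun p => (norm_exp_I_mul_mul _ _).le)
  exact this

theorem integral_polarization {X : Type*} [MeasurableSpace X] {μ : Measure X} {a b c d : X → ℂ}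
    (ha : Integrable a μ) (hb : Integrable b μ) (hc : Integrable c μ) (hd : Integrable d μ) :
    ∫ x, (a x - b x - Complex.I * c x + Complex.I * d x) / 4 ∂μ =
      (∫ x, a x ∂μ - ∫ x, b x ∂μ - Complex.I * ∫ x, c x ∂μ + Complex.I * ∫ x, d x ∂μ) / 4 := by
  have h1 : Integrable (fun x => a x - b x) μ := ha.sub hb
  have h2 : Integrable (fun x => a x - b x - Complex.I * c x) μ := h1.sub (hc.const_mul _)
  rw [integral_div, MeasureTheory.integral_add h2 (hd.const_mul _),
    MeasureTheory.integral_sub h1 (hc.const_mul _), MeasureTheory.integral_sub ha hb,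
    MeasureTheory.integral_const_mul, MeasureTheory.integral_const_mul]

theorem inner_integral_expTransform {h : ℝ → ℂ} (h1 : Integrable h) (y φ : H) :
    ⟪y, E.integral (expTransform h) φ⟫_ℂ = ∫ t, h t * ⟪y, E.group (-t) φ⟫_ℂ := by
  have hi (v : H) := E.integrable_mul_inner_group h1 v v
  have hp (T : H →L[ℂ] H) := inner_map_map_polarization (LinearMap.id : H →ₗ[ℂ] H)
    (T : H →ₗ[ℂ] H) y φ
  simp only [LinearMap.id_coe, id_eq, ContinuousLinearMap.coe_coe] at hp
  have e (t : ℝ) : h t * ⟪y, E.group (-t) φ⟫_ℂ =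
      (h t * ⟪y + φ, E.group (-t) (y + φ)⟫_ℂ - h t * ⟪y - φ, E.group (-t) (y - φ)⟫_ℂ
      - Complex.I * (h t * ⟪y + Complex.I • φ, E.group (-t) (y + Complex.I • φ)⟫_ℂ)
      + Complex.I * (h t * ⟪y - Complex.I • φ, E.group (-t) (y - Complex.I • φ)⟫_ℂ)) / 4 := by
    rw [hp]
    ring
  simp_rw [e]
  rw [integral_polarization (hi _) (hi _) (hi _) (hi _), hp]
  simp only [E.inner_self_integral_expTransform h1]

/-- Matrix elements of the group at vectors with bounded spectral density are square integrable. -/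
theorem exists_lintegral_inner_group_le {φ : H} (hφ : φ ∈ E.boundedDensity) :
    ∃ C : NNReal, ∀ x : H, ∫⁻ t : ℝ, ‖⟪x, E.group (-t) φ⟫_ℂ‖ₑ ^ 2 ≤ C * ‖x‖ₑ ^ 2 := by
  obtain ⟨f, hf, hμ⟩ := hφ
  obtain ⟨c, hc⟩ : ∃ c : NNReal, ∀ᵐ x, ‖f x‖ₑ ≤ c := by
    have h := hf.eLpNorm_ne_top
    rw [eLpNorm_exponent_top] at h
    refine ⟨(eLpNormEssSup f volume).toNNReal, ?_⟩
    rw [ENNReal.coe_toNNReal h]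
    exact enorm_ae_le_eLpNormEssSup f volume
  have hle : E.scalarMeasure φ ≤ ((c : ℝ≥0∞) ^ 2) • (volume : Measure ℝ) := by
    rw [hμ, ← withDensity_const]
    exact withDensity_mono (hc.mono fun x hx => pow_le_pow_left' hx 2)
  have hC : (c : ℝ≥0∞) ^ 2 * ENNReal.ofReal (2 * Real.pi) ≠ ∞ :=
    ENNReal.mul_ne_top (by simp) ENNReal.ofReal_ne_top
  refine ⟨((c : ℝ≥0∞) ^ 2 * ENNReal.ofReal (2 * Real.pi)).toNNReal, fun x => ?_⟩
  rw [ENNReal.coe_toNNReal hC]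
  set C := (c : ℝ≥0∞) ^ 2 * ENNReal.ofReal (2 * Real.pi) with hCdef
  have hgc : Continuous fun t : ℝ => ⟪x, E.group (-t) φ⟫_ℂ :=
    continuous_const.inner ((E.continuous_group_apply φ).comp continuous_neg)
  have hcov := aecover_Icc (μ := (volume : Measure ℝ)) (l := atTop) (a := fun n : ℕ => -(n : ℝ))
    (b := fun n : ℕ => (n : ℝ)) (tendsto_neg_atTop_atBot.comp tendsto_natCast_atTop_atTop)
    tendsto_natCast_atTop_atTop
  refine le_of_tendsto (hcov.lintegral_tendsto_of_countably_generated
    (hgc.measurable.enorm.pow_const 2).aemeasurable) (Eventually.of_forall fun n => ?_)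
  set N := ∫⁻ t in Set.Icc (-(n : ℝ)) n, ‖⟪x, E.group (-t) φ⟫_ℂ‖ₑ ^ 2 with hN
  -- Duality: integrating the matrix element against its own truncated conjugate gives N = ⟨x, Tφ⟩
  -- with T = ∫ ĥ dE.
  let h : ℝ → ℂ := (Set.Icc (-(n : ℝ)) n).indicator fun t =>
    starRingEnd ℂ ⟪x, E.group (-t) φ⟫_ℂ
  have hstarc : Continuous fun t : ℝ => starRingEnd ℂ ⟪x, E.group (-t) φ⟫_ℂ :=
    Complex.continuous_conj.comp hgc
  have h1 : Integrable h :=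
    (integrable_indicator_iff measurableSet_Icc).2 (hstarc.integrableOn_Icc)
  have h2 : MemLp h 2 volume := by
    rw [memLp_indicator_iff_restrict measurableSet_Icc]
    exact (memLp_top_of_bound hstarc.aestronglyMeasurable (‖x‖ * ‖φ‖)
      (Eventually.of_forall fun t => by
        rw [RCLike.norm_conj]
        exact (norm_inner_le_norm _ _).trans_eq (by rw [E.norm_group_apply]))).mono_exponent
      le_top
  have hNh : ∫⁻ t, ‖h t‖ₑ ^ 2 = N := by
    rw [hN, ← lintegral_indicator measurableSet_Icc]
    refine lintegral_congr fun t => ?_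
    by_cases ht : t ∈ Set.Icc (-(n : ℝ)) n
    · simp only [h, Set.indicator_of_mem ht]
      rw [← ofReal_norm, RCLike.norm_conj, ofReal_norm]
    · simp [h, Set.indicator_of_notMem ht]
  have hNtop : N ≠ ∞ := by
    rw [← hNh]
    have := h2.eLpNorm_lt_top
    rw [eLpNorm_lt_top_iff_lintegral_rpow_enorm_lt_top (by norm_num) (by norm_num)] at this
    simpa using this.ne
  have hinner : ‖⟪x, E.integral (expTransform h) φ⟫_ℂ‖ₑ = N := by
    rw [E.inner_integral_expTransform h1]
    have e (t : ℝ) : h t * ⟪x, E.group (-t) φ⟫_ℂ = ((‖h t‖ ^ 2 : ℝ) : ℂ) := by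
      by_cases ht : t ∈ Set.Icc (-(n : ℝ)) n
      · simp only [h, Set.indicator_of_mem ht]
        rw [RCLike.norm_conj, Complex.conj_mul', Complex.ofReal_pow]
      · simp [h, Set.indicator_of_notMem ht]
    simp_rw [e]
    rw [integral_complex_ofReal, ← hNh, ← ofReal_norm, Complex.norm_real,
      Real.norm_of_nonneg (integral_nonneg fun t => by positivity),
      ofReal_integral_eq_lintegral_ofReal
        (MemLp.integrable_norm_pow (p := 2) (by exact_mod_cast h2) two_ne_zero)
        (Eventually.of_forall fun t => by positivity)]
    refine lintegral_congr fun t => ?_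
    rw [← ofReal_norm, ← ENNReal.ofReal_pow (norm_nonneg _)]
  -- The density bound c² replaces the spectral measure by Lebesgue measure, after which Plancherel
  -- applies.
  have hnorm : ‖E.integral (expTransform h) φ‖ₑ ^ 2 ≤ C * N := by
    rw [E.lintegral_enorm_sq (isBddMeasurable_expTransform h1)]
    refine (lintegral_mono' hle le_rfl).trans_eq ?_
    rw [lintegral_smul_measure, lintegral_enorm_sq_expTransform h1 h2, hNh, smul_eq_mul, hCdef,
      mul_assoc]
  -- The truncation to [-n, n] makes N finite, so one factor N can be cancelled.
  have hfin : N * N ≤ (C * ‖x‖ₑ ^ 2) * N := by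
    calc N * N = N ^ 2 := (sq N).symm
      _ ≤ (‖x‖ₑ * ‖E.integral (expTransform h) φ‖ₑ) ^ 2 := by
        gcongr
        rw [← hinner, ← ofReal_norm, ← ofReal_norm, ← ofReal_norm,
          ← ENNReal.ofReal_mul (norm_nonneg _)]
        exact ENNReal.ofReal_le_ofReal (norm_inner_le_norm _ _)
      _ = ‖x‖ₑ ^ 2 * ‖E.integral (expTransform h) φ‖ₑ ^ 2 := mul_pow _ _ _
      _ ≤ ‖x‖ₑ ^ 2 * (C * N) := by gcongr
      _ = _ := by ring
  by_cases hN0 : N = 0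
  · rw [hN0]
    exact zero_le
  · exact (ENNReal.mul_le_mul_iff_left hN0 hNtop).1 hfin

end ProjectionValuedMeasure

/-! ### Trace class operators as products of Hilbert-Schmidt operators -/

/-- A trace class operator is a product of two Hilbert-Schmidt operators. -/
theorem IsTraceClass.exists_mul {T : H →L[ℂ] H} (hT : IsTraceClass T) :
    ∃ (s : Set H) (b : HilbertBasis s ℂ H) (G S : H →L[ℂ] H), T = G * S ∧
      Summable (fun i => ‖star S (b i)‖ ^ 2) ∧ Summable (fun i => ‖G (b i)‖ ^ 2) := by
  obtain ⟨s, b, hs⟩ := hT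
  -- S = |T|^{1/2}, so Σ‖S bᵢ‖² is the trace of |T|.
  set S := CFC.sqrt (CFC.abs T) with hS
  have hSS : S * S = CFC.abs T := CFC.sqrt_mul_sqrt_self _ (CFC.abs_nonneg T)
  have hstar : star S = S := (CFC.sqrt_nonneg (CFC.abs T)).isSelfAdjoint.star_eq
  have hSsymm (x y : H) : ⟪S x, y⟫_ℂ = ⟪x, S y⟫_ℂ := by
    conv_lhs => rw [← hstar, ContinuousLinearMap.star_eq_adjoint,
      ContinuousLinearMap.adjoint_inner_left]
  have hnormT (v : H) : ‖T v‖ = ‖S (S v)‖ := by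
    have h1 : star T * T = (S * S) * (S * S) := by rw [hSS, CFC.abs_mul_abs]
    have h2 := congrArg (fun Q : H →L[ℂ] H => ⟪v, Q v⟫_ℂ) h1
    simp only [mul_apply_eq_comp, ContinuousLinearMap.star_eq_adjoint,
      ContinuousLinearMap.adjoint_inner_right] at h2
    rw [← hSsymm, ← hSsymm, inner_self_eq_norm_sq_to_K, inner_self_eq_norm_sq_to_K] at h2
    have h3 : ‖T v‖ ^ 2 = ‖S (S v)‖ ^ 2 := by exact_mod_cast h2
    exact (pow_left_inj₀ (norm_nonneg _) (norm_nonneg _) two_ne_zero).1 h3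
  have hsumS : Summable fun i => ‖S (b i)‖ ^ 2 := by
    refine hs.congr fun i => ?_
    rw [← hSS, mul_apply_eq_comp, ← hSsymm, inner_self_eq_norm_sq_to_K]
    norm_cast
  -- In place of a polar decomposition, G is fixed by G(Sv) = Tv on the closed range of S and by 0
  -- on its complement. From ‖Tv‖ = ‖S(Sv)‖ one gets ‖Gx‖ = ‖Sx‖, so G is Hilbert–Schmidt as well.
  let W := (LinearMap.range (S : H →ₗ[ℂ] H)).topologicalClosure
  have hW (v : H) : S v ∈ W := Submodule.le_topologicalClosure _ ⟨v, rfl⟩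
  have : CompleteSpace W := (Submodule.isClosed_topologicalClosure _).completeSpace_coe
  let e : H →ₗ[ℂ] W := (S : H →ₗ[ℂ] H).codRestrict W hW
  have he (v : H) : ((e v : W) : H) = S v := rfl
  have hdense : DenseRange e := by
    intro w
    rw [Topology.IsInducing.subtypeVal.closure_eq_preimage_closure_image, Set.mem_preimage,
      ← Set.range_comp]
    exact w.2
  have hbound (v : H) : ‖T v‖ ≤ ‖S‖ * ‖e v‖ := by
    rw [hnormT]
    exact S.le_opNorm _
  let G₀ : W →L[ℂ] H := (T : H →ₗ[ℂ] H).extendOfNorm e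
  have hG₀ (v : H) : G₀ (e v) = T v := LinearMap.extendOfNorm_eq hdense ⟨‖S‖, hbound⟩ v
  have hG₀norm (w : W) : ‖G₀ w‖ = ‖S w‖ := by
    refine hdense.induction_on (p := fun w : W => ‖G₀ w‖ = ‖S w‖) w
      (isClosed_eq (by fun_prop) (by fun_prop)) fun v => ?_
    rw [hG₀, hnormT, he]
  let G : H →L[ℂ] H := G₀ ∘L W.orthogonalProjectionOnto
  have hGnorm (x : H) : ‖G x‖ = ‖S x‖ := by
    have h0 : S (x - W.starProjection x) = 0 := by
      rw [← inner_self_eq_zero (𝕜 := ℂ), hSsymm]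
      exact W.starProjection_inner_eq_zero x _ (hW _)
    rw [map_sub, sub_eq_zero] at h0
    rw [h0]
    exact hG₀norm _
  refine ⟨s, b, G, S, ?_, by rwa [hstar], hsumS.congr fun i => by rw [hGnorm]⟩
  ext v
  have h1 : W.orthogonalProjectionOnto (S v) = e v :=
    Submodule.orthogonalProjectionOnto_mem_subspace_eq_self (e v)
  change T v = G₀ (W.orthogonalProjectionOnto (S v))
  rw [h1, hG₀]

theorem hasSum_norm_inner_sq {ι : Type*} (b : HilbertBasis ι ℂ H) (v : H) :
    HasSum (fun i => ‖⟪b i, v⟫_ℂ‖ ^ 2) (‖v‖ ^ 2) := by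
  have h := b.hasSum_inner_mul_inner v v
  have e (i : ι) : ⟪v, b i⟫_ℂ * ⟪b i, v⟫_ℂ = ((‖⟪b i, v⟫_ℂ‖ ^ 2 : ℝ) : ℂ) := by
    rw [← inner_conj_symm, Complex.conj_mul', Complex.ofReal_pow]
  simp_rw [e] at h
  rw [inner_self_eq_norm_sq_to_K] at h
  rw [← Complex.hasSum_ofReal]
  simpa using h

theorem enorm_sq_eq_tsum {ι : Type*} (b : HilbertBasis ι ℂ H) (v : H) :
    ‖v‖ₑ ^ 2 = ∑' i, ‖⟪b i, v⟫_ℂ‖ₑ ^ 2 := by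
  have h2 := hasSum_norm_inner_sq b v
  rw [← ofReal_norm, ← ENNReal.ofReal_pow (norm_nonneg _), ← h2.tsum_eq,
    ENNReal.ofReal_tsum_of_nonneg (fun i => by positivity) h2.summable]
  exact tsum_congr fun i => by rw [← ofReal_norm, ← ENNReal.ofReal_pow (norm_nonneg _)]

theorem tsum_enorm_sq_ne_top {ι : Type*} {v : ι → H} (h : Summable fun i => ‖v i‖ ^ 2) :
    ∑' i, ‖v i‖ₑ ^ 2 ≠ ∞ := by
  have e (i : ι) : ‖v i‖ₑ ^ 2 = ENNReal.ofReal (‖v i‖ ^ 2) := by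
    rw [← ofReal_norm, ← ENNReal.ofReal_pow (norm_nonneg _)]
  simp_rw [e]
  rw [← ENNReal.ofReal_tsum_of_nonneg (fun i => by positivity) h]
  exact ENNReal.ofReal_ne_top

/-- Hilbert-Schmidt operators are smooth along the orbits of vectors with bounded spectral
density. -/
theorem ProjectionValuedMeasure.lintegral_enorm_sq_hilbertSchmidt_le
    (E : ProjectionValuedMeasure H) {φ : H}
    {C : NNReal} (hC : ∀ x : H, ∫⁻ t : ℝ, ‖⟪x, E.group (-t) φ⟫_ℂ‖ₑ ^ 2 ≤ C * ‖x‖ₑ ^ 2)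
    {ι : Type*} (b : HilbertBasis ι ℂ H) {Q : H →L[ℂ] H}
    (hQ : Summable fun i => ‖star Q (b i)‖ ^ 2) (L : H →L[ℂ] H) :
    ∫⁻ t : ℝ, ‖Q (L (E.group (-t) φ))‖ₑ ^ 2 ≤
      C * (‖L‖ₑ ^ 2 * ∑' i, ‖star Q (b i)‖ₑ ^ 2) := by
  -- H may be nonseparable; only countably many basis vectors contribute, which permits exchanging
  -- sum and integral.
  have hcount : (Function.support fun i => ‖star Q (b i)‖ ^ 2).Countable := hQ.countable_support
  set I := Function.support fun i => ‖star Q (b i)‖ ^ 2 with hI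
  have hzero (i : ι) (hi : i ∉ I) : star Q (b i) = 0 := by
    simpa [hI] using hi
  have : Countable I := hcount.to_subtype
  have e (t : ℝ) : ‖Q (L (E.group (-t) φ))‖ₑ ^ 2 =
      ∑' i : I, ‖⟪star L (star Q (b i)), E.group (-t) φ⟫_ℂ‖ₑ ^ 2 := by
    have e1 (i : ι) : ⟪b i, Q (L (E.group (-t) φ))⟫_ℂ =
        ⟪star L (star Q (b i)), E.group (-t) φ⟫_ℂ := by
      simp only [ContinuousLinearMap.star_eq_adjoint, ContinuousLinearMap.adjoint_inner_left]
    rw [enorm_sq_eq_tsum b]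
    simp_rw [e1]
    symm
    refine tsum_subtype_eq_of_support_subset (s := I)
      (f := fun i => ‖⟪star L (star Q (b i)), E.group (-t) φ⟫_ℂ‖ₑ ^ 2) fun i hi => ?_
    by_contra h'
    exact hi (by simp [hzero i h'])
  simp_rw [e]
  rw [lintegral_tsum fun i => ?_]
  · calc ∑' i : I, ∫⁻ t : ℝ, ‖⟪star L (star Q (b i)), E.group (-t) φ⟫_ℂ‖ₑ ^ 2
        ≤ ∑' i : I, C * (‖L‖ₑ ^ 2 * ‖star Q (b i)‖ₑ ^ 2) := by
          refine ENNReal.tsum_le_tsum fun i => (hC _).trans ?_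
          gcongr
          rw [← mul_pow]
          gcongr
          have := (star L).le_opNorm (star Q (b i))
          rw [norm_star] at this
          rw [← ofReal_norm, ← ofReal_norm, ← ofReal_norm, ← ENNReal.ofReal_mul (norm_nonneg _)]
          exact ENNReal.ofReal_le_ofReal this
      _ = C * (‖L‖ₑ ^ 2 * ∑' i : I, ‖star Q (b i)‖ₑ ^ 2) := by
          rw [ENNReal.tsum_mul_left, ENNReal.tsum_mul_left]
      _ ≤ _ := by
          gcongr
          exact ENNReal.tsum_comp_le_tsum_of_injective Subtype.val_injective _
  · have hc : Continuous fun t : ℝ => ⟪star L (star Q (b i)), E.group (-t) φ⟫_ℂ :=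
      continuous_const.inner ((E.continuous_group_apply φ).comp continuous_neg)
    exact (hc.measurable.enorm.pow_const 2).aemeasurable

/-! ### Convergence of orbits with slowly varying differences -/

section Orbits

/-- By the mean value inequality far out, a small derivative over the fixed distance |t − s| gives a
small difference. -/
theorem tendsto_sub_of_deriv_tendsto_zero {y y' : ℝ → H} (hy : ∀ r, HasDerivAt y (y' r) r)
    (h0 : Tendsto y' atTop (𝓝 0)) (t s : ℝ) :
    Tendsto (fun a => y (t + a) - y (s + a)) atTop (𝓝 0) := by
  rw [NormedAddGroup.tendsto_nhds_zero]
  intro ε hε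
  have hη : 0 < ε / (|t - s| + 1) := by positivity
  obtain ⟨r, hr⟩ := eventually_atTop.1 ((NormedAddGroup.tendsto_nhds_zero.1 h0) _ hη)
  filter_upwards [eventually_ge_atTop (r - t), eventually_ge_atTop (r - s)] with a ha ha'
  have hs : s + a ∈ Set.Ici r := by rw [Set.mem_Ici]; linarith
  have ht : t + a ∈ Set.Ici r := by rw [Set.mem_Ici]; linarith
  have h := (convex_Ici r).norm_image_sub_le_of_norm_hasDerivWithin_le
    (fun x _ => (hy x).hasDerivWithinAt) (fun x hx => (hr x hx).le) hs ht
  refine h.trans_lt ?_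
  rw [add_sub_add_right_eq_sub, Real.norm_eq_abs, div_mul_eq_mul_div, div_lt_iff₀ (by positivity)]
  nlinarith [abs_nonneg (t - s)]

/-- A continuous function whose integrals over `[0, n]` are bounded by `M`. -/
structure IntegralBound (f : ℝ → ℝ) (M : ℝ) : Prop where
  continuous : Continuous f
  le : ∀ n : ℝ, 0 ≤ n → ∫ a in (0 : ℝ)..n, f a ≤ M

theorem IntegralBound.add {f g : ℝ → ℝ} {M N : ℝ} (hf : IntegralBound f M)
    (hg : IntegralBound g N) : IntegralBound (fun a => f a + g a) (M + N) :=
  ⟨hf.continuous.add hg.continuous, fun n hn => by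
    rw [intervalIntegral.integral_add (hf.continuous.intervalIntegrable _ _)
      (hg.continuous.intervalIntegrable _ _)]
    exact add_le_add (hf.le n hn) (hg.le n hn)⟩

theorem IntegralBound.const_mul {f : ℝ → ℝ} {M c : ℝ} (hf : IntegralBound f M) (hc : 0 ≤ c) :
    IntegralBound (fun a => c * f a) (c * M) :=
  ⟨continuous_const.mul hf.continuous, fun n hn => by
    rw [intervalIntegral.integral_const_mul]
    exact mul_le_mul_of_nonneg_left (hf.le n hn) hc⟩

theorem integralBound_of_integrableOn {g : ℝ → ℝ} (hc : Continuous g) (h0 : ∀ r, 0 ≤ g r) {p : ℝ}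
    (hp : 0 ≤ p) (hg : IntegrableOn g (Set.Ioi 0)) :
    IntegralBound (fun a => g (p + a)) (∫ r in Set.Ioi p, g r) :=
  ⟨hc.comp (continuous_const_add p), fun n hn => by
    rw [intervalIntegral.integral_comp_add_left, add_zero,
      intervalIntegral.integral_of_le (by linarith)]
    exact setIntegral_mono_set (hg.mono_set (Set.Ioi_subset_Ioi hp))
      (Eventually.of_forall h0) (Set.Ioc_subset_Ioi_self.eventuallyLE)⟩

/-- The derivative of ‖Δ(a)‖² is 2 Re⟨Δ, Δ'⟩. Integrating from 0 to n and letting n → ∞, where Δ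
vanishes, bounds its value at a = 0. -/
theorem norm_sub_sq_le_of_integralBound {y y' : ℝ → H} (hy : ∀ r, HasDerivAt y (y' r) r)
    (hc : Continuous y') (h0 : Tendsto y' atTop (𝓝 0)) (t s : ℝ) {F : ℝ → ℝ} {M : ℝ}
    (hF : IntegralBound F M)
    (hle : ∀ a, 0 ≤ a → ‖⟪y (t + a) - y (s + a), y' (t + a) - y' (s + a)⟫_ℂ‖ ≤ F a) :
    ‖y t - y s‖ ^ 2 ≤ 2 * M := by
  set Δ : ℝ → H := fun a => y (t + a) - y (s + a) with hΔ
  set Δ' : ℝ → H := fun a => y' (t + a) - y' (s + a) with hΔ'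
  have hd (a : ℝ) : HasDerivAt Δ (Δ' a) a :=
    ((hy (t + a)).comp_const_add t a).sub ((hy (s + a)).comp_const_add s a)
  have hΔc : Continuous Δ := continuous_iff_continuousAt.2 fun a => (hd a).continuousAt
  have hΔ'c : Continuous Δ' :=
    (hc.comp (continuous_const_add t)).sub (hc.comp (continuous_const_add s))
  have hq (a : ℝ) : HasDerivAt (fun a => ⟪Δ a, Δ a⟫_ℂ) (⟪Δ a, Δ' a⟫_ℂ + ⟪Δ' a, Δ a⟫_ℂ) a :=
    (hd a).inner ℂ (hd a)
  have hq'c : Continuous fun a => ⟪Δ a, Δ' a⟫_ℂ + ⟪Δ' a, Δ a⟫_ℂ :=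
    (hΔc.inner hΔ'c).add (hΔ'c.inner hΔc)
  have hbound (n : ℝ) (hn : 0 ≤ n) : ‖y t - y s‖ ^ 2 ≤ ‖Δ n‖ ^ 2 + 2 * M := by
    have h1 := intervalIntegral.integral_eq_sub_of_hasDerivAt (a := 0) (b := n)
      (fun a _ => hq a) (hq'c.intervalIntegrable _ _)
    have h2 : ‖∫ a in (0 : ℝ)..n, (⟪Δ a, Δ' a⟫_ℂ + ⟪Δ' a, Δ a⟫_ℂ)‖ ≤
        ∫ a in (0 : ℝ)..n, 2 * F a := by
      refine intervalIntegral.norm_integral_le_of_norm_le hn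
        (Eventually.of_forall fun a ha => ?_)
        ((continuous_const.mul hF.continuous).intervalIntegrable _ _)
      have h3 := hle a ha.1.le
      have h4 : ‖⟪Δ' a, Δ a⟫_ℂ‖ = ‖⟪Δ a, Δ' a⟫_ℂ‖ := norm_inner_symm _ _
      refine (norm_add_le _ _).trans ?_
      rw [h4]
      linarith
    have h5 := (hF.const_mul zero_le_two).le n hn
    have h6 : ‖⟪Δ 0, Δ 0⟫_ℂ‖ ≤ ‖⟪Δ n, Δ n⟫_ℂ‖ + 2 * M := by
      have : ⟪Δ 0, Δ 0⟫_ℂ = ⟪Δ n, Δ n⟫_ℂ -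
          ∫ a in (0 : ℝ)..n, (⟪Δ a, Δ' a⟫_ℂ + ⟪Δ' a, Δ a⟫_ℂ) := by
        rw [h1]
        ring
      rw [this]
      refine (norm_sub_le _ _).trans ?_
      linarith
    have h7 (v : H) : ‖⟪v, v⟫_ℂ‖ = ‖v‖ ^ 2 := by
      rw [inner_self_eq_norm_sq_to_K]
      simp
    rw [h7, h7] at h6
    simpa [hΔ] using h6
  have hlim := (tendsto_sub_of_deriv_tendsto_zero hy h0 t s).norm.pow 2
  rw [norm_zero, zero_pow two_ne_zero] at hlim
  have := ge_of_tendsto (hlim.add_const (2 * M))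
    ((eventually_ge_atTop 0).mono fun n hn => hbound n hn)
  simpa using this

theorem exists_tendsto_of_norm_sub_sq_le {y : ℝ → H} {κ : ℝ} {A : ℝ → ℝ} {B : ℝ → ℝ}
    (hκ : 0 ≤ κ) (hA : Tendsto A atTop (𝓝 0)) (hB : Tendsto B atTop (𝓝 0))
    (h : ∀ t s ε : ℝ, 0 ≤ t → 0 ≤ s → 0 < ε →
      ‖y t - y s‖ ^ 2 ≤ ε * κ + ε⁻¹ * (A t + A s) + (B t + B s)) :
    ∃ l, Tendsto y atTop (𝓝 l) := by
  refine cauchySeq_tendsto_of_complete (Metric.cauchySeq_iff'.2 fun δ hδ => ?_)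
  -- ε is fixed before the tails are made small: the κ term costs δ²/4 and the four tail terms less
  -- than δ²/16 each, so less than δ²/2 in all.
  set ε := δ ^ 2 / (4 * (κ + 1)) with hε
  have hε0 : 0 < ε := by positivity
  have h1 : ε * κ ≤ δ ^ 2 / 4 := by
    rw [hε, div_mul_eq_mul_div, div_le_div_iff₀ (by positivity) (by norm_num)]
    nlinarith [sq_nonneg δ]
  have hη : 0 < δ ^ 2 / 16 := by positivity
  have hA' := (hA.const_mul ε⁻¹)
  rw [mul_zero] at hA'
  obtain ⟨N, hN⟩ := eventually_atTop.1 (((hA'.eventually_lt_const hη).and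
    (hB.eventually_lt_const hη)).and (eventually_ge_atTop 0))
  refine ⟨N, fun t ht => ?_⟩
  obtain ⟨⟨a1, b1⟩, c1⟩ := hN t ht
  obtain ⟨⟨a2, b2⟩, c2⟩ := hN N le_rfl
  have h2 := h t N ε c1 c2 hε0
  rw [dist_eq_norm]
  refine lt_of_pow_lt_pow_left₀ 2 hδ.le ?_
  rw [mul_add] at h2
  nlinarith [sq_pos_of_pos hδ]

end Orbits

/-! ### Wave operators -/

namespace ProjectionValuedMeasure

variable (E : ProjectionValuedMeasure H)

/-- Expanding in the basis, every coefficient tends to 0, and summability of ‖Q⋆bᵢ‖² dominates the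
series. -/
theorem tendsto_hilbertSchmidt_group {φ : H} (hφ : φ ∈ E.acSubspace) {ι : Type*}
    (b : HilbertBasis ι ℂ H) {Q : H →L[ℂ] H} (hQ : Summable fun i => ‖star Q (b i)‖ ^ 2) :
    Tendsto (fun t : ℝ => Q (E.group (-t) φ)) atTop (𝓝 0) := by
  have e (t : ℝ) : ‖Q (E.group (-t) φ)‖ ^ 2 =
      ∑' i, ‖⟪star Q (b i), E.group (-t) φ⟫_ℂ‖ ^ 2 := by
    rw [← (hasSum_norm_inner_sq b (Q (E.group (-t) φ))).tsum_eq]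
    simp only [ContinuousLinearMap.star_eq_adjoint, ContinuousLinearMap.adjoint_inner_left]
  have h : Tendsto (fun t : ℝ => ‖Q (E.group (-t) φ)‖ ^ 2) atTop (𝓝 (∑' _ : ι, (0 : ℝ))) := by
    simp_rw [e]
    refine tendsto_tsum_of_dominated_convergence (bound := fun i => ‖star Q (b i)‖ ^ 2 * ‖φ‖ ^ 2)
      (hQ.mul_right _) (fun i => ?_) (Eventually.of_forall fun t i => ?_)
    · simpa using (E.tendsto_inner_group (star Q (b i)) hφ).norm.pow 2
    · rw [norm_pow, norm_norm, ← mul_pow]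
      gcongr
      exact (norm_inner_le_norm _ _).trans_eq (by rw [E.norm_group_apply])
  rw [tsum_zero] at h
  have h1 := h.sqrt
  simp only [Real.sqrt_sq (norm_nonneg _), Real.sqrt_zero] at h1
  exact tendsto_zero_iff_norm_tendsto_zero.2 h1

theorem tendsto_group_apply {ι : Type*} {l : Filter ι} {r : ι → ℝ} {t : ℝ} {v : ι → H} {v₀ : H}
    (hr : Tendsto r l (𝓝 t)) (hv : Tendsto v l (𝓝 v₀)) :
    Tendsto (fun i => E.group (r i) (v i)) l (𝓝 (E.group t v₀)) := by
  have h1 : Tendsto (fun i => E.group (r i) (v i - v₀)) l (𝓝 0) := by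
    rw [tendsto_zero_iff_norm_tendsto_zero]
    simp_rw [E.norm_group_apply]
    exact tendsto_iff_norm_sub_tendsto_zero.1 hv
  have h2 := h1.add (((E.continuous_group_apply v₀).tendsto t).comp hr)
  rw [zero_add] at h2
  refine h2.congr fun i => ?_
  simp

theorem continuous_group_comp {v : ℝ → H} (hv : Continuous v) :
    Continuous fun t => E.group t (v t) :=
  continuous_iff_continuousAt.2 fun t => E.tendsto_group_apply tendsto_id (hv.tendsto t)

end ProjectionValuedMeasure

/-- Product rule for a group that is only strongly continuous: split g(r) = g(t) + (g(r) − g(t)).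
The generator handles the first part, strong continuity the second. -/
theorem IsSpectralMeasure.hasDerivAt_comp {A : H →ₗ.[ℂ] H} {E : ProjectionValuedMeasure H}
    (hE : IsSpectralMeasure A E) (hd : Dense (A.domain : Set H)) {g : ℝ → H} {g' : H} {t : ℝ}
    (hg : HasDerivAt g g' t) (ht : g t ∈ A.domain) :
    HasDerivAt (fun r => E.group r (g r))
      (Complex.I • E.group t (A ⟨g t, ht⟩) + E.group t g') t := by
  have h1 := hE.hasDerivAt hd ⟨g t, ht⟩ t
  have h2 : HasDerivAt (fun r => E.group r (g r - g t)) (E.group t g') t := by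
    rw [hasDerivAt_iff_tendsto_slope]
    have h3 := E.tendsto_group_apply (tendsto_id.mono_left nhdsWithin_le_nhds)
      (hasDerivAt_iff_tendsto_slope.1 hg)
    refine h3.congr fun r => ?_
    simp only [slope_def_module, id_eq, sub_self, map_zero, sub_zero]
    rw [← Complex.coe_smul, map_smul, Complex.coe_smul]
  refine (h1.add h2).congr_of_eventuallyEq (Eventually.of_forall fun r => ?_)
  simp

/-! ### Differentiating the orbit regularized by resolvents. -/

section Commutator

variable {A B : H →ₗ.[ℂ] H} {EA EB : ProjectionValuedMeasure H} {z : ℂ} {RA RB K : H →L[ℂ] H}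

theorem IsSpectralMeasure.resolvent_group (hEB : IsSpectralMeasure B EB)
    (hdB : Dense (B.domain : Set H)) (hRB : IsResolventAt B z RB) (t : ℝ) (φ : H) :
    RB (EB.group t φ) = EB.group t (RB φ) := by
  have h := hEB.commute_resolvent hdB (ProjectionValuedMeasure.isBddMeasurable_exp t)
    (fun x => ProjectionValuedMeasure.norm_exp_I_mul_mul x t) hRB
  exact congrArg (fun Q : H →L[ℂ] H => Q φ) h.eq

/-- The terms z R_A K R_B produced by A R_A = 1 + z R_A and B R_B = 1 + z R_B cancel, leaving the
bounded operator K R_B − R_A K. -/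
theorem hasDerivAt_resolvent_orbit (hEA : IsSpectralMeasure A EA) (hEB : IsSpectralMeasure B EB)
    (hdA : Dense (A.domain : Set H)) (hdB : Dense (B.domain : Set H))
    (hRA : IsResolventAt A z RA) (hRB : IsResolventAt B z RB) (φ : H) (t : ℝ) :
    HasDerivAt (fun t => EA.group t ((RA * K * RB) (EB.group (-t) φ)))
      (Complex.I • EA.group t ((K * RB - RA * K) (EB.group (-t) φ))) t := by
  have h1 : HasDerivAt (fun t => RB (EB.group (-t) φ))
      (-(Complex.I • EB.group (-t) (φ + z • RB φ))) t := by
    have h2 := (hEB.hasDerivAt hdB ⟨RB φ, hRB.mem_domain φ⟩ (-t)).scomp t (hasDerivAt_neg t)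
    rw [hRB.apply φ] at h2
    simp_rw [hEB.resolvent_group hdB hRB]
    exact h2.congr_deriv (by rw [neg_one_smul])
  have h3 := ((RA * K).restrictScalars ℝ).hasFDerivAt.comp_hasDerivAt t h1
  have h4 := hEA.hasDerivAt_comp hdA (g := fun t => (RA * K * RB) (EB.group (-t) φ)) h3
    (hRA.mem_domain _)
  refine h4.congr_deriv ?_
  have e : A ⟨(RA * K * RB) (EB.group (-t) φ), hRA.mem_domain _⟩ =
      K (RB (EB.group (-t) φ)) + z • RA (K (RB (EB.group (-t) φ))) := hRA.apply _
  rw [e]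
  have e2 : ((RA * K).restrictScalars ℝ) (-(Complex.I • EB.group (-t) (φ + z • RB φ))) =
      -(Complex.I • (RA (K (EB.group (-t) φ)) + z • RA (K (RB (EB.group (-t) φ))))) := by
    rw [hEB.resolvent_group hdB hRB]
    simp
  rw [e2]
  simp only [map_add, map_neg, map_smul, sub_apply, mul_apply_eq_comp, map_sub]
  module

end Commutator

/-! ### Pearson's estimate. -/

section Pearson

variable {EA EB : ProjectionValuedMeasure H} {J C G S C₂ : H →L[ℂ] H}

/-- The trace class method: an orbit whose derivative is a sum of a product of Hilbert-Schmidt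
operators and of an integrable term converges. -/
theorem exists_tendsto_orbit {φ : H}
    (hder : ∀ t, HasDerivAt (fun t => EA.group t (J (EB.group (-t) φ)))
      (Complex.I • EA.group t (C (EB.group (-t) φ))) t)
    (hC : C = G * S + C₂) {ι : Type*} (b : HilbertBasis ι ℂ H)
    (hS : Summable fun i => ‖star S (b i)‖ ^ 2) (hG : Summable fun i => ‖G (b i)‖ ^ 2)
    (hφ : φ ∈ EB.boundedDensity)
    (hlim : Tendsto (fun t : ℝ => C₂ (EB.group (-t) φ)) atTop (𝓝 0))
    (hint : IntegrableOn (fun t : ℝ => ‖C₂ (EB.group (-t) φ)‖) (Set.Ioi 0)) :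
    ∃ l, Tendsto (fun t => EA.group t (J (EB.group (-t) φ))) atTop (𝓝 l) := by
  obtain ⟨D, hD⟩ := EB.exists_lintegral_inner_group_le hφ
  have hVc : Continuous fun t : ℝ => EB.group (-t) φ :=
    (EB.continuous_group_apply φ).comp continuous_neg
  have hsq (f : ℝ → H) (hf : Continuous f) {M : ℝ≥0∞} (hM : M ≠ ∞)
      (h : ∫⁻ t, ‖f t‖ₑ ^ 2 ≤ M) : Integrable (fun t => ‖f t‖ ^ 2) ∧
        ∫ t, ‖f t‖ ^ 2 ≤ M.toReal := by
    have e (t : ℝ) : ‖f t‖ₑ ^ 2 = ENNReal.ofReal (‖f t‖ ^ 2) := by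
      rw [← ofReal_norm, ← ENNReal.ofReal_pow (norm_nonneg _)]
    simp_rw [e] at h
    have h0 : 0 ≤ᵐ[volume] fun t => ‖f t‖ ^ 2 := Eventually.of_forall fun t => by positivity
    have hc : Continuous fun t => ‖f t‖ ^ 2 := by fun_prop
    refine ⟨⟨hc.aestronglyMeasurable, ?_⟩, ?_⟩
    · rw [hasFiniteIntegral_iff_ofReal h0]
      exact h.trans_lt hM.lt_top
    · rw [integral_eq_lintegral_of_nonneg_ae h0 hc.aestronglyMeasurable]
      exact ENNReal.toReal_mono hM h
  have hG' : Summable fun i => ‖star (star G) (b i)‖ ^ 2 := by simpa using hG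
  set α : ℝ → ℝ := fun r => ‖S (EB.group (-r) φ)‖ ^ 2 with hα
  have hαc : Continuous α := by fun_prop
  have hαi : Integrable α := (hsq (fun r => S (EB.group (-r) φ)) (by fun_prop)
    (ENNReal.mul_ne_top ENNReal.coe_ne_top
      (ENNReal.mul_ne_top (by simp) (tsum_enorm_sq_ne_top hS)))
    (EB.lintegral_enorm_sq_hilbertSchmidt_le hD b hS 1)).1
  set γ : ℝ → ℝ := fun r => ‖C₂ (EB.group (-r) φ)‖ with hγ
  have hγc : Continuous γ := by fun_prop
  -- The time τ in the A-group is decoupled from the integration time r. Since that group is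
  -- isometric, the bound M on the integral over r does not depend on τ.
  set β : ℝ → ℝ → ℝ := fun τ r => ‖star G (EA.group τ (J (EB.group (-r) φ)))‖ ^ 2 with hβ
  have hβc (τ : ℝ) : Continuous (β τ) := by fun_prop
  set M : ℝ≥0∞ := D * (‖J‖ₑ ^ 2 * ∑' i, ‖star (star G) (b i)‖ₑ ^ 2) with hM
  have hMtop : M ≠ ∞ := ENNReal.mul_ne_top ENNReal.coe_ne_top
    (ENNReal.mul_ne_top (by simp) (tsum_enorm_sq_ne_top hG'))
  have hβi (τ : ℝ) : Integrable (β τ) ∧ ∫ r, β τ r ≤ M.toReal := by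
    refine hsq (fun r => star G (EA.group τ (J (EB.group (-r) φ)))) (by fun_prop) hMtop ?_
    refine (EB.lintegral_enorm_sq_hilbertSchmidt_le hD b hG' (EA.group τ * J)).trans ?_
    rw [hM]
    gcongr
    rw [← ofReal_norm, ← ofReal_norm]
    refine ENNReal.ofReal_le_ofReal (ContinuousLinearMap.opNorm_le_bound _ (norm_nonneg _)
      fun v => ?_)
    rw [mul_apply_eq_comp, EA.norm_group_apply]
    exact J.le_opNorm v
  have hβb (τ : ℝ) {p : ℝ} (hp : 0 ≤ p) : IntegralBound (fun a => β τ (p + a)) M.toReal := by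
    have h := integralBound_of_integrableOn (hβc τ) (fun r => by positivity) hp
      (hβi τ).1.integrableOn
    refine ⟨h.continuous, fun n hn => (h.le n hn).trans (le_trans ?_ (hβi τ).2)⟩
    exact setIntegral_le_integral (hβi τ).1 (Eventually.of_forall fun r => by positivity)
  -- A uniform bound for ‖Δ‖, used to pair Δ with the C₂ term.
  set k := 2 * (‖J‖ * ‖φ‖) with hk
  have hk0 : 0 ≤ k := by positivity
  have hC0 : Tendsto (fun t : ℝ => C (EB.group (-t) φ)) atTop (𝓝 0) := by
    have h1 := (G.continuous.tendsto 0).comp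
      (EB.tendsto_hilbertSchmidt_group (EB.boundedDensity_subset hφ) b hS)
    rw [map_zero] at h1
    have h2 := h1.add hlim
    rw [add_zero] at h2
    refine h2.congr fun t => ?_
    rw [hC]
    rfl
  have hy'0 : Tendsto (fun t : ℝ => Complex.I • EA.group t (C (EB.group (-t) φ))) atTop (𝓝 0) := by
    rw [tendsto_zero_iff_norm_tendsto_zero] at hC0 ⊢
    refine hC0.congr fun t => ?_
    rw [norm_smul, Complex.norm_I, one_mul, EA.norm_group_apply]
  have hy'c : Continuous fun t : ℝ => Complex.I • EA.group t (C (EB.group (-t) φ)) :=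
    (EA.continuous_group_comp (by fun_prop)).const_smul _
  have hpt (t s p a ε : ℝ) (hε : 0 < ε) :
      ‖⟪EA.group (t + a) (J (EB.group (-(t + a)) φ)) - EA.group (s + a) (J (EB.group (-(s + a)) φ)),
        Complex.I • EA.group (p + a) (C (EB.group (-(p + a)) φ))⟫_ℂ‖ ≤
      (ε * (β (t - p) (t + a) + β (s - p) (s + a)) + ε⁻¹ * α (p + a)) + k * γ (p + a) := by
    set Δ := EA.group (t + a) (J (EB.group (-(t + a)) φ)) -
      EA.group (s + a) (J (EB.group (-(s + a)) φ)) with hΔ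
    have hΔn : ‖Δ‖ ≤ k := by
      have h (r : ℝ) : ‖EA.group r (J (EB.group (-r) φ))‖ ≤ ‖J‖ * ‖φ‖ := by
        rw [EA.norm_group_apply]
        exact (J.le_opNorm _).trans_eq (by rw [EB.norm_group_apply])
      exact (norm_sub_le _ _).trans (by linarith [h (t + a), h (s + a)])
    have e1 : ⟪Δ, EA.group (p + a) (G (S (EB.group (-(p + a)) φ)))⟫_ℂ =
        ⟪star G (EA.group (t - p) (J (EB.group (-(t + a)) φ))) -
          star G (EA.group (s - p) (J (EB.group (-(s + a)) φ))), S (EB.group (-(p + a)) φ)⟫_ℂ := by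
      rw [← map_sub, ContinuousLinearMap.star_eq_adjoint, ContinuousLinearMap.adjoint_inner_left]
      -- Undoing the A-evolution by p + a cancels a in the A-group.
      have e2 : EA.group (t - p) (J (EB.group (-(t + a)) φ)) -
          EA.group (s - p) (J (EB.group (-(s + a)) φ)) = EA.group (-(p + a)) Δ := by
        rw [hΔ, map_sub, ← EA.group_add_apply, ← EA.group_add_apply]
        ring_nf
      rw [e2, EA.inner_group_left, neg_neg]
    rw [inner_smul_right, norm_mul, Complex.norm_I, one_mul, hC, add_apply, mul_apply_eq_comp,
      map_add, inner_add_right]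
    refine (norm_add_le _ _).trans (add_le_add ?_ ?_)
    · rw [e1]
      refine (norm_inner_le_norm _ _).trans ?_
      have hs := norm_sub_le (star G (EA.group (t - p) (J (EB.group (-(t + a)) φ))))
        (star G (EA.group (s - p) (J (EB.group (-(s + a)) φ))))
      simp only [hβ, hα]
      set u := ‖star G (EA.group (t - p) (J (EB.group (-(t + a)) φ)))‖
      set v := ‖star G (EA.group (s - p) (J (EB.group (-(s + a)) φ)))‖
      set w := ‖S (EB.group (-(p + a)) φ)‖
      have hw : 0 ≤ w := norm_nonneg _
      refine (mul_le_mul_of_nonneg_right hs hw).trans ?_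
      have hεε : ε * ε⁻¹ = 1 := mul_inv_cancel₀ hε.ne'
      have hi : 0 < ε⁻¹ := inv_pos.2 hε
      -- This is (u + v)w ≤ ε(u² + v²) + w²/ε, by completing squares.
      nlinarith [mul_nonneg hi.le (sq_nonneg (ε * u - w / 2)),
        mul_nonneg hi.le (sq_nonneg (ε * v - w / 2)), mul_nonneg hi.le (sq_nonneg w)]
    · refine (norm_inner_le_norm _ _).trans ?_
      rw [EA.norm_group_apply]
      exact mul_le_mul_of_nonneg_right hΔn (norm_nonneg _)
  -- Two β terms for each of p = t and p = s, doubled by the bound on ‖y(t) − y(s)‖², give 8M; the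
  -- tails carry the same factor 2.
  refine exists_tendsto_of_norm_sub_sq_le (κ := 8 * M.toReal)
    (A := fun p => 2 * ∫ r in Set.Ioi p, α r) (B := fun p => 2 * (k * ∫ r in Set.Ioi p, γ r))
    (by positivity) ?_ ?_ fun t s ε ht hs hε => ?_
  · simpa using (tendsto_integral_Ioi_zero (f := α) (μ := volume) tendsto_id).const_mul 2
  · simpa using ((tendsto_integral_Ioi_zero (f := γ) (μ := volume)
      tendsto_id).const_mul k).const_mul 2
  · have hF (p : ℝ) (hp : 0 ≤ p) :=
      (((hβb (t - p) ht).add (hβb (s - p) hs)).const_mul hε.le).add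
        ((integralBound_of_integrableOn hαc (fun r => by positivity) hp
          hαi.integrableOn).const_mul (inv_pos.2 hε).le) |>.add
        ((integralBound_of_integrableOn hγc (fun r => norm_nonneg _) hp hint).const_mul hk0)
    refine (norm_sub_sq_le_of_integralBound hder hy'c hy'0 t s ((hF t ht).add (hF s hs))
      fun a _ => ?_).trans_eq (by ring)
    rw [inner_sub_right]
    exact (norm_sub_le _ _).trans (add_le_add (hpt t s t a ε hε) (hpt t s s a ε hε))

end Pearson

theorem isResolventAt_resolvent {A : H →ₗ.[ℂ] H} {z : ℂ} (hz : z ∈ resolventSet A) :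
    IsResolventAt A z (resolvent A z) := by
  have h : ∃ R : H →L[ℂ] H, IsResolventAt A z R := hz
  unfold resolvent
  exact (dif_pos h).symm ▸ h.choose_spec

theorem tendsto_zero_of_mem_closure {W : ℝ → H →L[ℂ] H} {c : ℝ} (hc : ∀ t v, ‖W t v‖ ≤ c * ‖v‖)
    {S : Set H} (hS : ∀ φ ∈ S, Tendsto (fun t => W t φ) atTop (𝓝 0)) {φ : H}
    (hφ : φ ∈ closure S) : Tendsto (fun t => W t φ) atTop (𝓝 0) := by
  have hc' : 0 ≤ |c| := abs_nonneg c
  rw [Metric.tendsto_atTop]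
  intro ε hε
  obtain ⟨ψ, hψ, hd⟩ := Metric.mem_closure_iff.1 hφ (ε / (2 * (|c| + 1))) (by positivity)
  obtain ⟨N, hN⟩ := Metric.tendsto_atTop.1 (hS ψ hψ) (ε / 2) (by positivity)
  refine ⟨N, fun t ht => ?_⟩
  have h1 := hN t ht
  rw [dist_zero_right] at h1 ⊢
  rw [dist_eq_norm, lt_div_iff₀ (by positivity)] at hd
  have h2 := hc t (φ - ψ)
  have h3 : W t φ = W t (φ - ψ) + W t ψ := by rw [map_sub, sub_add_cancel]
  have h4 : c * ‖φ - ψ‖ ≤ (|c| + 1) * ‖φ - ψ‖ :=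
    mul_le_mul_of_nonneg_right (by linarith [le_abs_self c]) (norm_nonneg _)
  rw [h3]
  linarith [norm_add_le (W t (φ - ψ)) (W t ψ)]

/-- The common bound c makes the family equicontinuous, so the Cauchy property passes to the
closure. -/
theorem exists_tendsto_of_mem_closure {W : ℝ → H →L[ℂ] H} {c : ℝ}
    (hc : ∀ t v, ‖W t v‖ ≤ c * ‖v‖) {S : Set H}
    (hS : ∀ φ ∈ S, ∃ l, Tendsto (fun t => W t φ) atTop (𝓝 l)) {φ : H} (hφ : φ ∈ closure S) :
    ∃ l, Tendsto (fun t => W t φ) atTop (𝓝 l) := by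
  have hc' : 0 ≤ |c| := abs_nonneg c
  refine cauchySeq_tendsto_of_complete (Metric.cauchySeq_iff.2 fun ε hε => ?_)
  obtain ⟨ψ, hψ, hd⟩ := Metric.mem_closure_iff.1 hφ (ε / (3 * (|c| + 1))) (by positivity)
  obtain ⟨l, hl⟩ := hS ψ hψ
  obtain ⟨N, hN⟩ := Metric.cauchySeq_iff.1 hl.cauchySeq (ε / 3) (by positivity)
  refine ⟨N, fun t ht s hs => ?_⟩
  have h1 := hN t ht s hs
  rw [dist_eq_norm] at h1 hd ⊢
  rw [lt_div_iff₀ (by positivity)] at hd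
  have h3 : W t φ - W s φ = W t (φ - ψ) - W s (φ - ψ) + (W t ψ - W s ψ) := by
    simp only [map_sub]
    abel
  have h4 : c * ‖φ - ψ‖ ≤ (|c| + 1) * ‖φ - ψ‖ :=
    mul_le_mul_of_nonneg_right (by linarith [le_abs_self c]) (norm_nonneg _)
  rw [h3]
  linarith [norm_add_le (W t (φ - ψ) - W s (φ - ψ)) (W t ψ - W s ψ),
    norm_sub_le (W t (φ - ψ)) (W s (φ - ψ)), hc t (φ - ψ), hc s (φ - ψ)]

theorem norm_group_comp_group_le (EA EB : ProjectionValuedMeasure H) (T : H →L[ℂ] H) (t : ℝ)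
    (v : H) : ‖(EA.group t * T * EB.group (-t)) v‖ ≤ ‖T‖ * ‖v‖ := by
  rw [mul_apply_eq_comp, mul_apply_eq_comp, EA.norm_group_apply]
  exact (T.le_opNorm _).trans_eq (by rw [EB.norm_group_apply])

theorem IsResolventAt.injective_star {B : H →ₗ.[ℂ] H} {z : ℂ} {R : H →L[ℂ] H}
    (hB : IsSelfAdjoint B) (hR : IsResolventAt B z R) :
    Function.Injective (star R : H →L[ℂ] H) := by
  refine (injective_iff_map_eq_zero _).2 fun y hy => ?_
  obtain ⟨h, e⟩ := hR.adjoint_apply hB y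
  have h0 : (⟨star R y, h⟩ : B.domain) = 0 := Subtype.ext hy
  rw [h0, hy, smul_zero, add_zero, LinearPMap.map_zero] at e
  exact e.symm

/-! ### From the regularized orbit back to K. -/

section WaveOperator

variable {A B : H →ₗ.[ℂ] H} {EA EB : ProjectionValuedMeasure H} {z : ℂ}
  {RA RB K C₁ C₂ : H →L[ℂ] H} {M : Set H}

/-- On R_B²ψ, replacing K R_B by C + R_A K gives an orbit of R_A K R_B at ψ plus an orbit of C at
R_Bψ; the first converges and the second vanishes. Density and uniform boundedness do the rest. -/
theorem exists_tendsto_wave (hEA : IsSpectralMeasure A EA) (hEB : IsSpectralMeasure B EB)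
    (hdA : Dense (A.domain : Set H)) (hB : IsSelfAdjoint B)
    (hRA : IsResolventAt A z RA) (hRB : IsResolventAt B z RB)
    (hC : K * RB - RA * K = C₁ + C₂) (hC₁ : IsTraceClass C₁)
    (hM : M ⊆ EB.boundedDensity) (hM_dense : EB.boundedDensity ⊆ closure M)
    (hlim : ∀ φ ∈ M, Tendsto (fun t : ℝ => C₂ (EB.group (-t) φ)) atTop (𝓝 0))
    (hint : ∀ φ ∈ M, IntegrableOn (fun t : ℝ => ‖C₂ (EB.group (-t) φ)‖) (Set.Ioi 0))
    {φ : H} (hφ : φ ∈ EB.acSubspace) :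
    ∃ l, Tendsto (fun t => (EA.group t * K * EB.group (-t)) φ) atTop (𝓝 l) := by
  have hdB : Dense (B.domain : Set H) := hB.dense_domain
  obtain ⟨s, b, G, S, rfl, hS, hG⟩ := hC₁.exists_mul
  have hcl : (EB.acSubspace : Set H) ⊆ closure M :=
    EB.acSubspace_subset_closure_boundedDensity.trans (closure_minimal hM_dense isClosed_closure)
  have hJ (ψ : H) (hψ : ψ ∈ EB.acSubspace) :
      ∃ l, Tendsto (fun t => (EA.group t * (RA * K * RB) * EB.group (-t)) ψ) atTop (𝓝 l) :=
    exists_tendsto_of_mem_closure (norm_group_comp_group_le EA EB _)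
      (fun χ hχ => exists_tendsto_orbit
        (hasDerivAt_resolvent_orbit hEA hEB hdA hdB hRA hRB χ) hC b hS hG (hM hχ)
        (hlim χ hχ) (hint χ hχ)) (hcl hψ)
  have hC0 (ψ : H) (hψ : ψ ∈ EB.acSubspace) :
      Tendsto (fun t => (K * RB - RA * K) (EB.group (-t) ψ)) atTop (𝓝 0) := by
    have h1 := (G.continuous.tendsto 0).comp (EB.tendsto_hilbertSchmidt_group hψ b hS)
    rw [map_zero] at h1
    have h2 : Tendsto (fun t => (C₂ * EB.group (-t)) ψ) atTop (𝓝 0) :=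
      tendsto_zero_of_mem_closure (W := fun t => C₂ * EB.group (-t)) (c := ‖C₂‖)
        (fun t v => (C₂.le_opNorm (EB.group (-t) v)).trans_eq (by rw [EB.norm_group_apply])) hlim
        (hcl hψ)
    rw [hC]
    simpa using h1.add h2
  have hcomm (T : Set ℝ) (hT : MeasurableSet T) : Commute RB (EB.proj T) :=
    hEB.commute_resolvent_proj hdB hT hRB
  -- Two resolvents are needed: one turns K R_B into C + R_A K, the other remains to form R_A K R_B.
  have hinj : Function.Injective (star (RB * RB) : H →L[ℂ] H) := by
    rw [star_mul]
    exact (hRB.injective_star hB).comp (hRB.injective_star hB)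
  refine exists_tendsto_of_mem_closure (norm_group_comp_group_le EA EB _) ?_
    (EB.acSubspace_le_closure_map (fun T hT => (hcomm T hT).mul_left (hcomm T hT)) hinj hφ)
  rintro _ ⟨ψ, hψ, rfl⟩
  obtain ⟨l, hl⟩ := hJ ψ hψ
  have h0 : Tendsto (fun t => EA.group t ((K * RB - RA * K) (EB.group (-t) (RB ψ)))) atTop
      (𝓝 0) := by
    have h := hC0 (RB ψ) (EB.map_mem_acSubspace hcomm hψ)
    rw [tendsto_zero_iff_norm_tendsto_zero] at h ⊢
    exact h.congr fun t => (EA.norm_group_apply _ _).symm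
  refine ⟨l + 0, (hl.add h0).congr fun t => ?_⟩
  simp only [mul_apply_eq_comp, sub_apply, map_sub, ← hEB.resolvent_group hdB hRB]
  abel

end WaveOperator

end Scattering

end

theorem mainTheorem5 {H : Type*} [NormedAddCommGroup H] [InnerProductSpace ℂ H] [CompleteSpace H]
    (A B : H →ₗ.[ℂ] H) (hA : IsSelfAdjoint A) (hB : IsSelfAdjoint B)
    (K : H →L[ℂ] H) (z : ℂ)
    (hzA : z ∈ Scattering.resolventSet A) (hzB : z ∈ Scattering.resolventSet B)
    (C₁ C₂ : H →L[ℂ] H)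
    (hC : K ∘L Scattering.resolvent B z - Scattering.resolvent A z ∘L K = C₁ + C₂)
    (hC₁ : Scattering.IsTraceClass C₁)
    (M : Set H) (hM : M ⊆ Scattering.boundedDensitySet B)
    (hM_dense : Scattering.boundedDensitySet B ⊆ closure M)
    (hlim : ∀ φ ∈ M, Tendsto (fun t : ℝ => C₂ (Scattering.expI B (-t) φ)) atTop (𝓝 0))
    (hint : ∀ φ ∈ M,
      IntegrableOn (fun t : ℝ => ‖C₂ (Scattering.expI B (-t) φ)‖) (Set.Ioi 0) volume) :
    ∃ Ω : H →L[ℂ] H, ∀ φ : H,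
      Tendsto (fun t : ℝ => Scattering.expI A t (K (Scattering.expI B (-t) (Scattering.Pac B φ))))
        atTop (𝓝 (Ω φ)) := by
  have h (φ : H) := Scattering.exists_tendsto_wave
    (Scattering.isSpectralMeasure_spectralMeasure hA hzA)
    (Scattering.isSpectralMeasure_spectralMeasure hB hzB) hA.dense_domain hB
    (Scattering.isResolventAt_resolvent hzA) (Scattering.isResolventAt_resolvent hzB) hC hC₁
    hM hM_dense hlim hint ((Scattering.spectralMeasure B).acProj_mem φ)
  choose l hl using h
  -- The pointwise limit is linear, and bounded by the uniform boundedness principle.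
  exact ⟨continuousLinearMapOfTendsto (fun t : ℝ => Scattering.expI A t * K *
    Scattering.expI B (-t) * Scattering.Pac B) (f := l) (tendsto_pi_nhds.2 hl), hl⟩
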